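/- Let $c>1$ be a constant. For a positive integer $d\ge c$ let $Q^d$ be the $d$-dimensional binary cube, i.e. the graph with vertex set $\{0,1\}^d$ in which two vertices are adjacent if and only if they differ in exactly one coordinate, let $p=c/d$, and let $Q^d_p$ be the random subgraph of $Q^d$ on the same vertex set obtained by retaining every edge of $Q^d$ independently with probability $p$. Then the equation $y=1-e^{-cy}$ has a unique positive solution $y=y(c)$, it satisfies $0<y<1$, and for every $\varepsilon>0$, with probability tending to $1$ as $d\to\infty$, the graph $Q^d_p$ has a connected component $L_1$ with $\bigl||L_1|-y2^d\bigr|\le \varepsilon\, y2^d$ such that every connected component $L\ne L_1$ of $Q^d_p$ satisfies $|L|\le \dfrac{d}{c-1-\ln c}$ (here $|\cdot|$ denotes the number of vertices). In other words, with high probability $Q^d_p$ has a component of size $(1+o(1))\,y\,2^d$, and all its other components have size at most $d/(c-1-\ln c)$. -/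

import Mathlib

open MeasureTheory ProbabilityTheory Filter Topology

/-- The `d`-dimensional binary cube `Q^d`: the vertex set is `{0,1}^d`, and two vertices are
adjacent iff they differ in exactly one coordinate (`hammingDist` counts the coordinates in
which two vectors differ). -/
def binaryCube (d : ℕ) : SimpleGraph (Fin d → Bool) where
  Adj x y := hammingDist x y = 1
  symm := ⟨fun x y h => by rw [hammingDist_comm]; exact h⟩
  loopless := ⟨fun x h => by simp at h⟩

/-- The law of the random subgraph `G_p` of `G`: each edge of `G` is retained independently with
probability `p` (the vertex set is unchanged). The random edge set has law
`setBernoulli G.edgeSet p`, the product of Bernoulli distributions on the edges of `G`. -/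
noncomputable def percolation {V : Type*} (G : SimpleGraph V) (p : unitInterval) :
    Measure (SimpleGraph V) :=
  (setBernoulli G.edgeSet p).map SimpleGraph.fromEdgeSet

/-! Put `I = c - 1 - ln c`. Up to subexponential factors, a vertex of the cube lies in at most `(e
d)^s` trees with `s` vertices. Such a tree is open with probability `(c/d)^(s-1)`, and by edge
isoperimetry at least `s (d - log₂ s)` edges leave its vertex set. So for `s ≤ 2^(κ d)` the expected
number of open trees of size `s` at a vertex with closed boundary is at most `exp (-β s)`, where `β`
is as close to `I` as desired when `κ` is small (`card_trees_mul_le`, `card_mul_le_card_boundary`,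
`pr_tree_size_le`). Since `ln 2 < 3/4`, the choice `β = 3 I / 4` beats a union bound over the `2^d`
vertices once `s > d / I`: no component has size between `d / I` and `2^(κ d)`.

To see that only one component is larger, the edges are exposed in two layers, the first with
probability `(1 - κ) c / d`. In the first layer every vertex is two flips away from a component with
more than `d / I` vertices (`eventually_near`), which therefore has more than `2^(κ d)` of them.
Whenever these components are divided into two families, short connections between the families
occur at many well separated places, so the second layer fails to join them with probability doubly
exponentially small. This survives a union bound over all divisions (`pr_not_merged_le`). A large
component of the union of the layers must contain a large one of the first layer: otherwise
first-layer components could be glued together one at a time until a tree of forbidden size appears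
(`exists_large_comp_or_hasMiddleTree`). For this reason the tree bound is stated for edges open in
the union and a boundary closed in the first layer.

For the size of the giant, fix a large `k` and count the vertices from which a path of `k` edges
starts. Every vertex of the giant is one of them, because a Hamming ball of radius `k` is too small
to hold the giant; the remaining ones lie in components of intermediate size and are few
(`exists_giant`). The probability of such a path tends to the survival probability of a Poisson
branching process up to generation `k` (`pr_longPath_le`, `le_pr_geoPath`), the count is
concentrated by Chebyshev (`variance_count_le`), and the survival probabilities decrease to `y`
(`exists_survival_limit`). -/

/-- A probability distribution on a finite type, given by its weights. -/
structure FinProb (Ω : Type*) [Fintype Ω] where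
  w : Ω → ℝ
  nonneg : ∀ ω, 0 ≤ w ω
  sum_eq_one : ∑ ω, w ω = 1

/-! ### Finite probability spaces. -/

namespace FinProb
open Finset
open scoped Classical

section basic
variable {Ω Ω' : Type*} [Fintype Ω] [Fintype Ω'] (P : FinProb Ω)

/-- The expectation of a real function. -/
noncomputable def ex (f : Ω → ℝ) : ℝ := ∑ ω, P.w ω * f ω

/-- The probability of an event. -/
noncomputable def pr (A : Ω → Prop) : ℝ := P.ex fun ω => if A ω then 1 else 0

theorem ex_mono {f g : Ω → ℝ} (h : ∀ ω, f ω ≤ g ω) : P.ex f ≤ P.ex g :=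
  Finset.sum_le_sum fun ω _ => mul_le_mul_of_nonneg_left (h ω) (P.nonneg ω)

theorem ex_add (f g : Ω → ℝ) : P.ex (fun ω => f ω + g ω) = P.ex f + P.ex g := by
  simp [ex, mul_add, Finset.sum_add_distrib]

theorem ex_const_mul (a : ℝ) (f : Ω → ℝ) : P.ex (fun ω => a * f ω) = a * P.ex f := by
  simp only [ex, Finset.mul_sum]
  exact Finset.sum_congr rfl fun ω _ => by ring

theorem ex_const (a : ℝ) : P.ex (fun _ => a) = a := by
  simp [ex, ← Finset.sum_mul, P.sum_eq_one]

theorem ex_sum {ι : Type*} (s : Finset ι) (f : ι → Ω → ℝ) :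
    P.ex (fun ω => ∑ i ∈ s, f i ω) = ∑ i ∈ s, P.ex (f i) := by
  simp only [ex, Finset.mul_sum]
  exact Finset.sum_comm

theorem pr_nonneg (A : Ω → Prop) : 0 ≤ P.pr A :=
  Finset.sum_nonneg fun ω _ => mul_nonneg (P.nonneg ω) (by dsimp only; split_ifs <;> norm_num)

theorem pr_mono {A B : Ω → Prop} (h : ∀ ω, A ω → B ω) : P.pr A ≤ P.pr B := by
  refine P.ex_mono fun ω => ?_
  by_cases hA : A ω
  · simp [hA, h ω hA]
  · simp only [hA, if_false]; split_ifs <;> norm_num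

theorem pr_congr {A B : Ω → Prop} (h : ∀ ω, A ω ↔ B ω) : P.pr A = P.pr B :=
  le_antisymm (P.pr_mono fun ω => (h ω).1) (P.pr_mono fun ω => (h ω).2)

theorem pr_true : P.pr (fun _ => True) = 1 := by simp [pr, ex_const]

theorem pr_false : P.pr (fun _ => False) = 0 := by simp [pr, ex_const]

theorem pr_le_one (A : Ω → Prop) : P.pr A ≤ 1 :=
  (P.pr_mono fun _ _ => trivial).trans P.pr_true.le

theorem pr_or_add_and (A B : Ω → Prop) :
    P.pr (fun ω => A ω ∨ B ω) + P.pr (fun ω => A ω ∧ B ω) = P.pr A + P.pr B := by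
  rw [pr, pr, pr, pr, ← ex_add, ← ex_add]
  congr 1; ext ω
  by_cases hA : A ω <;> by_cases hB : B ω <;> simp [hA, hB]

theorem pr_or_le (A B : Ω → Prop) : P.pr (fun ω => A ω ∨ B ω) ≤ P.pr A + P.pr B := by
  have := P.pr_or_add_and A B
  have := P.pr_nonneg fun ω => A ω ∧ B ω
  linarith

theorem pr_not (A : Ω → Prop) : P.pr (fun ω => ¬ A ω) = 1 - P.pr A := by
  have h := P.pr_or_add_and A fun ω => ¬ A ω
  have h1 : P.pr (fun ω => A ω ∨ ¬ A ω) = 1 := by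
    rw [← P.pr_true]; exact P.pr_congr fun ω => by tauto
  have h2 : P.pr (fun ω => A ω ∧ ¬ A ω) = 0 := by
    rw [← P.pr_false]; exact P.pr_congr fun ω => by tauto
  linarith

theorem pr_exists_le {ι : Type*} (s : Finset ι) (A : ι → Ω → Prop) :
    P.pr (fun ω => ∃ i ∈ s, A i ω) ≤ ∑ i ∈ s, P.pr (A i) := by
  unfold pr
  rw [← ex_sum]
  refine P.ex_mono fun ω => ?_
  split_ifs with h
  · obtain ⟨i, hi, hA⟩ := h
    calc (1 : ℝ) = if A i ω then 1 else 0 := by simp [hA]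
      _ ≤ _ := Finset.single_le_sum (f := fun i => if A i ω then (1 : ℝ) else 0)
        (fun _ _ => by split_ifs <;> norm_num) hi
  · exact Finset.sum_nonneg fun _ _ => by split_ifs <;> norm_num

theorem sum_pr_le_one {ι : Type*} (s : Finset ι) (A : ι → Ω → Prop)
    (h : ∀ ω, ∀ i ∈ s, ∀ j ∈ s, A i ω → A j ω → i = j) : ∑ i ∈ s, P.pr (A i) ≤ 1 := by
  unfold pr
  rw [← ex_sum]
  refine (P.ex_mono fun ω => ?_).trans_eq (P.ex_const 1)
  rw [Finset.sum_boole]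
  exact_mod_cast Finset.card_le_one.2 fun i hi j hj => by
    simp only [Finset.mem_filter] at hi hj
    exact h ω i hi.1 j hj.1 hi.2 hj.2

/-- Total probability over the values of a function. -/
theorem pr_eq_sum_fiber {ι : Type*} (s : Finset ι) (f : Ω → ι) (hf : ∀ ω, f ω ∈ s) (A : Ω → Prop) :
    P.pr A = ∑ i ∈ s, P.pr (fun ω => f ω = i ∧ A ω) := by
  unfold pr
  rw [← ex_sum]
  congr 1; ext ω
  by_cases hA : A ω
  · simp [hA, hf ω]
  · simp [hA]

/-- The number of the events `A i`, `i ∈ s`, that occur. -/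
noncomputable def count {ι : Type*} (s : Finset ι) (A : ι → Ω → Prop) (ω : Ω) : ℝ :=
  ((s.filter fun i => A i ω).card : ℝ)

omit [Fintype Ω] in
theorem count_eq_sum {ι : Type*} (s : Finset ι) (A : ι → Ω → Prop) (ω : Ω) :
    count s A ω = ∑ i ∈ s, if A i ω then (1 : ℝ) else 0 := by
  rw [count, Finset.sum_boole]

theorem ex_count {ι : Type*} (s : Finset ι) (A : ι → Ω → Prop) :
    P.ex (count s A) = ∑ i ∈ s, P.pr (A i) := by
  rw [show count s A = fun ω => ∑ i ∈ s, if A i ω then (1 : ℝ) else 0 from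
    funext fun ω => count_eq_sum s A ω, ex_sum]
  rfl

theorem markov {f : Ω → ℝ} (hf : ∀ ω, 0 ≤ f ω) (t : ℝ) :
    t * P.pr (fun ω => t ≤ f ω) ≤ P.ex f := by
  unfold pr
  rw [← ex_const_mul]
  refine P.ex_mono fun ω => ?_
  split_ifs with h
  · simpa using h
  · simpa using hf ω

theorem chebyshev_count {ι : Type*} (s : Finset ι) (A : ι → Ω → Prop) (t : ℝ) :
    t ^ 2 * P.pr (fun ω => t ^ 2 ≤ (count s A ω - ∑ i ∈ s, P.pr (A i)) ^ 2) ≤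
      ∑ i ∈ s, ∑ j ∈ s, (P.pr (fun ω => A i ω ∧ A j ω) - P.pr (A i) * P.pr (A j)) := by
  refine (P.markov (fun ω => sq_nonneg _) _).trans (le_of_eq ?_)
  set m := ∑ i ∈ s, P.pr (A i) with hm
  have h1 : P.ex (fun ω => count s A ω ^ 2) =
      ∑ i ∈ s, ∑ j ∈ s, P.pr (fun ω => A i ω ∧ A j ω) := by
    unfold pr
    simp_rw [← ex_sum]
    congr 1; ext ω
    rw [count_eq_sum, sq, Finset.sum_mul_sum]
    refine Finset.sum_congr rfl fun i _ => Finset.sum_congr rfl fun j _ => ?_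
    by_cases hA : A i ω <;> by_cases hB : A j ω <;> simp [hA, hB]
  have h2 : P.ex (fun ω => (count s A ω - m) ^ 2) =
      P.ex (fun ω => count s A ω ^ 2) - m ^ 2 := by
    have : (fun ω => (count s A ω - m) ^ 2) =
        fun ω => count s A ω ^ 2 + ((-2 * m) * count s A ω + m ^ 2) := by
      ext ω; ring
    rw [this, ex_add, ex_add, ex_const_mul, ex_const, ex_count, ← hm]; ring
  rw [h2, h1]
  simp_rw [Finset.sum_sub_distrib]
  rw [hm, sq, Finset.sum_mul_sum]

/-- The image distribution. -/
noncomputable def map (f : Ω → Ω') : FinProb Ω' where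
  w y := P.pr fun ω => f ω = y
  nonneg y := P.pr_nonneg _
  sum_eq_one := by
    have := P.pr_eq_sum_fiber univ f (fun _ => mem_univ _) fun _ => True
    rw [P.pr_true] at this
    simpa using this.symm

theorem ex_map (f : Ω → Ω') (g : Ω' → ℝ) : (P.map f).ex g = P.ex (fun ω => g (f ω)) := by
  simp only [ex, map, pr, Finset.sum_mul]
  rw [Finset.sum_comm]
  refine Finset.sum_congr rfl fun ω _ => ?_
  simp

theorem pr_map (f : Ω → Ω') (A : Ω' → Prop) : (P.map f).pr A = P.pr (fun ω => A (f ω)) := by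
  unfold pr; rw [ex_map]

theorem ext_w {P Q : FinProb Ω} (h : P.w = Q.w) : P = Q := by
  cases P; cases Q; simp_all

/-- The product of two distributions. -/
noncomputable def prod (Q : FinProb Ω') : FinProb (Ω × Ω') where
  w x := P.w x.1 * Q.w x.2
  nonneg x := mul_nonneg (P.nonneg _) (Q.nonneg _)
  sum_eq_one := by
    rw [Fintype.sum_prod_type]
    simp [← Finset.mul_sum, Q.sum_eq_one, P.sum_eq_one]

theorem w_map (f : Ω → Ω') (y : Ω') : (P.map f).w y = P.pr fun ω => f ω = y := rfl

theorem pr_eq (x : Ω) : P.pr (fun ω => ω = x) = P.w x := by simp [pr, ex]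

end basic

/-- The Bernoulli distribution. -/
noncomputable def ber (p : ℝ) (h0 : 0 ≤ p) (h1 : p ≤ 1) : FinProb Bool where
  w b := if b then p else 1 - p
  nonneg b := by cases b <;> simp [h0, h1]
  sum_eq_one := by simp

/-! ### Product distributions and independence. -/

section pi
variable {ι X Y : Type*} [Fintype ι] [DecidableEq ι] [Fintype X] [Fintype Y] (P : FinProb X)

/-- Independent identically distributed coordinates. -/
noncomputable def pi (ι : Type*) [Fintype ι] [DecidableEq ι] (P : FinProb X) : FinProb (ι → X) where
  w ω := ∏ i, P.w (ω i)
  nonneg ω := Finset.prod_nonneg fun i _ => P.nonneg _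
  sum_eq_one := by
    have := Finset.prod_univ_sum (fun _ : ι => (univ : Finset X)) fun _ x => P.w x
    simp only [P.sum_eq_one, Finset.prod_const_one, Fintype.piFinset_univ] at this
    exact this.symm

theorem pr_pi_forall (B : ι → X → Prop) :
    (pi ι P).pr (fun ω => ∀ i, B i (ω i)) = ∏ i, P.pr (B i) := by
  unfold pr ex pi
  rw [Finset.prod_univ_sum, Fintype.piFinset_univ]
  refine Finset.sum_congr rfl fun ω _ => ?_
  by_cases h : ∀ i, B i (ω i)
  · simp [h]
  · dsimp only
    rw [if_neg h]
    push Not at h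
    obtain ⟨i, hi⟩ := h
    rw [mul_zero]
    exact (Finset.prod_eq_zero (mem_univ i) (by simp [hi])).symm

theorem pr_pi_forall_mem (s : Finset ι) (B : ι → X → Prop) :
    (pi ι P).pr (fun ω => ∀ i ∈ s, B i (ω i)) = ∏ i ∈ s, P.pr (B i) := by
  rw [P.pr_pi_forall fun i x => i ∈ s → B i x, ← Finset.prod_subset (subset_univ s)]
  · exact Finset.prod_congr rfl fun i hi => P.pr_congr fun x => by simp [hi]
  · intro i _ hi
    rw [← P.pr_true]
    exact P.pr_congr fun x => by simp [hi]

theorem map_pi (f : X → Y) : (pi ι P).map (fun ω i => f (ω i)) = pi ι (P.map f) := by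
  refine ext_w (funext fun η => ?_)
  simp only [w_map, pi, funext_iff]
  exact P.pr_pi_forall fun i x => f x = η i

/-- Fubini for two layers of edges: sprinkling is analysed with the first layer held fixed. -/
theorem pr_pi_prod (Q : FinProb Y) (C : (ι → X) → (ι → Y) → Prop) :
    (pi ι (P.prod Q)).pr (fun ω => C (fun i => (ω i).1) (fun i => (ω i).2)) =
      (pi ι P).ex fun η => (pi ι Q).pr (C η) := by
  unfold pr ex
  simp_rw [Finset.mul_sum]
  rw [← Fintype.sum_prod_type', ← (Equiv.arrowProdEquivProdArrow ι (fun _ => X) fun _ => Y).sum_comp]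
  refine Finset.sum_congr rfl fun ω _ => ?_
  simp only [pi, prod, Equiv.arrowProdEquivProdArrow, Equiv.coe_fn_mk, Finset.prod_mul_distrib]
  by_cases h : C (fun i => (ω i).1) fun i => (ω i).2 <;> simp [h]

/-- Split the coordinates into `I` and its complement: `A` ignores the second block and `B` the
first, so the double sum factors. -/
theorem pr_pi_and {A B : (ι → X) → Prop} {I J : Set ι} (hA : DependsOn A I) (hB : DependsOn B J)
    (hIJ : Disjoint I J) :
    (pi ι P).pr (fun ω => A ω ∧ B ω) = (pi ι P).pr A * (pi ι P).pr B := by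
  have key : ∀ C : (ι → X) → Prop, (pi ι P).pr C =
      ∑ x : {i // i ∈ I} → X, ∑ y : {i // i ∉ I} → X, (∏ i, P.w (x i)) * (∏ i, P.w (y i)) *
        if C ((Equiv.piEquivPiSubtypeProd (· ∈ I) fun _ => X).symm (x, y)) then 1 else 0 := by
    intro C
    unfold pr ex
    rw [← Fintype.sum_prod_type', ← (Equiv.piEquivPiSubtypeProd (· ∈ I) fun _ => X).symm.sum_comp]
    refine Finset.sum_congr rfl fun z _ => ?_
    congr 1
    simp only [pi]
    rw [← Fintype.prod_subtype_mul_prod_subtype (fun i => i ∈ I)]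
    congr 1 <;> refine Finset.prod_congr rfl fun i _ => ?_ <;>
      simp [Equiv.piEquivPiSubtypeProd, i.2]
  rcases isEmpty_or_nonempty X with hX | hX
  · exact absurd P.sum_eq_one (by simp)
  obtain ⟨x₀⟩ := hX
  set e := (Equiv.piEquivPiSubtypeProd (· ∈ I) fun _ => X).symm with he
  have hA' : ∀ x y, A (e (x, y)) = A (e (x, fun _ => x₀)) := fun x y => hA fun i hi => by
    simp [he, Equiv.piEquivPiSubtypeProd, hi]
  have hB' : ∀ x y, B (e (x, y)) = B (e (fun _ => x₀, y)) := fun x y => hB fun i hi => by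
    have : i ∉ I := fun h => (Set.disjoint_left.1 hIJ h) hi
    simp [he, Equiv.piEquivPiSubtypeProd, this]
  have hs : ∀ (κ : Type _) [Fintype κ] [DecidableEq κ], ∑ y : κ → X, ∏ i, P.w (y i) = 1 :=
    fun κ => (pi κ P).sum_eq_one
  rw [key, key A, key B]
  simp_rw [hA', hB']
  have e1 : ∀ f : ({i // i ∈ I} → X) → ℝ, ∑ x : {i // i ∈ I} → X, ∑ y : {i // i ∉ I} → X,
      (∏ i, P.w (x i)) * (∏ i, P.w (y i)) * f x = ∑ x, (∏ i, P.w (x i)) * f x := fun f =>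
    Finset.sum_congr rfl fun x _ => by rw [← Finset.sum_mul, ← Finset.mul_sum, hs, mul_one]
  have e2 : ∀ f : ({i // i ∉ I} → X) → ℝ, ∑ x : {i // i ∈ I} → X, ∑ y : {i // i ∉ I} → X,
      (∏ i, P.w (x i)) * (∏ i, P.w (y i)) * f y = ∑ y, (∏ i, P.w (y i)) * f y := fun f => by
    simp_rw [mul_assoc, ← Finset.mul_sum]
    rw [← Finset.sum_mul, hs, one_mul]
  rw [e1, e2, Finset.sum_mul_sum]
  refine Finset.sum_congr rfl fun x _ => Finset.sum_congr rfl fun y _ => ?_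
  by_cases hA : A (e (x, fun _ => x₀)) <;> by_cases hB : B (e (fun _ => x₀, y)) <;>
    simp [hA, hB]

omit [Fintype ι] [DecidableEq ι] [Fintype X] in
theorem dependsOn_forall_mem {κ : Type*} {s : Finset κ} {A : κ → (ι → X) → Prop} {I : κ → Set ι}
    (h : ∀ i ∈ s, DependsOn (A i) (I i)) :
    DependsOn (fun ω => ∀ i ∈ s, A i ω) (⋃ i ∈ s, I i) := by
  intro ω ω' hω
  refine propext (forall₂_congr fun i hi => ?_)
  exact Eq.to_iff (h i hi fun j hj => hω j (Set.mem_biUnion (x := i) (by exact hi) hj))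

theorem pr_pi_forall_dependsOn {κ : Type*} (s : Finset κ) {A : κ → (ι → X) → Prop}
    {I : κ → Set ι} (h : ∀ i ∈ s, DependsOn (A i) (I i))
    (hd : ∀ i ∈ s, ∀ j ∈ s, i ≠ j → Disjoint (I i) (I j)) :
    (pi ι P).pr (fun ω => ∀ i ∈ s, A i ω) = ∏ i ∈ s, (pi ι P).pr (A i) := by
  induction s using Finset.induction_on with
  | empty => simp [pr_true]
  | insert a s ha ih =>
    simp only [Finset.forall_mem_insert] at h ⊢
    rw [Finset.prod_insert ha, ← ih h.2 fun i hi j hj => hd i (mem_insert_of_mem hi) j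
      (mem_insert_of_mem hj)]
    refine P.pr_pi_and h.1 (dependsOn_forall_mem h.2) ?_
    rw [Set.disjoint_iUnion₂_right]
    exact fun i hi => hd a (mem_insert_self _ _) i (mem_insert_of_mem hi) (by rintro rfl; exact ha hi)

end pi

/-! ### Positive correlation of increasing events. -/

section Harris
variable {ι : Type*} [Fintype ι] [DecidableEq ι] (P : FinProb Bool)

/-- Harris' inequality for increasing events. -/
theorem harris {A B : (ι → Bool) → Prop} (hA : Monotone A) (hB : Monotone B) :
    (pi ι P).pr A * (pi ι P).pr B ≤ (pi ι P).pr (fun ω => A ω ∧ B ω) := by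
  have hm : ∀ {C : (ι → Bool) → Prop}, Monotone C →
      Monotone fun ω => if C ω then (1 : ℝ) else 0 := by
    intro C hC ω ω' h
    dsimp only
    by_cases h1 : C ω
    · simp [h1, hC h h1]
    · simp only [h1, if_false]; split_ifs <;> norm_num
  have hn : ∀ {C : (ι → Bool) → Prop}, (0 : (ι → Bool) → ℝ) ≤ fun ω => if C ω then (1 : ℝ) else 0 :=
    fun ω => by dsimp only; split_ifs <;> norm_num
  have := fkg (μ := (pi ι P).w) (f := fun ω => if A ω then (1 : ℝ) else 0)
    (g := fun ω => if B ω then (1 : ℝ) else 0) (pi ι P).nonneg hn hn (hm hA) (hm hB) fun a b => by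
    simp only [pi, ← Finset.prod_mul_distrib]
    refine Finset.prod_le_prod (fun i _ => mul_nonneg (P.nonneg _) (P.nonneg _)) fun i _ => ?_
    simp only [Pi.inf_apply, Pi.sup_apply]
    cases a i <;> cases b i <;> simp [mul_comm]
  rw [(pi ι P).sum_eq_one, one_mul] at this
  refine this.trans (le_of_eq ?_)
  unfold pr ex
  refine Finset.sum_congr rfl fun ω _ => ?_
  by_cases h1 : A ω <;> by_cases h2 : B ω <;> simp [h1, h2]

theorem harris_not {A B : (ι → Bool) → Prop} (hA : Monotone A) (hB : Monotone B) :
    (pi ι P).pr (fun ω => ¬ A ω) * (pi ι P).pr (fun ω => ¬ B ω) ≤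
      (pi ι P).pr (fun ω => ¬ A ω ∧ ¬ B ω) := by
  have h1 := (pi ι P).pr_not A
  have h2 := (pi ι P).pr_not B
  have h3 := (pi ι P).pr_not fun ω => A ω ∨ B ω
  have h4 := (pi ι P).pr_or_add_and A B
  have h5 := P.harris hA hB
  simp only [not_or] at h3
  rw [h1, h2, h3]
  linarith

/-- The complements are decreasing, hence positively correlated. This bounds a union from above as
if its events were independent. -/
theorem harris_exists {κ : Type*} (s : Finset κ) {A : κ → (ι → Bool) → Prop}
    (hA : ∀ i ∈ s, Monotone (A i)) :
    ∏ i ∈ s, (1 - (pi ι P).pr (A i)) ≤ 1 - (pi ι P).pr (fun ω => ∃ i ∈ s, A i ω) := by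
  simp_rw [← pr_not]
  induction s using Finset.induction_on with
  | empty => simp [pr_true]
  | insert a s ha ih =>
    rw [Finset.prod_insert ha]
    simp only [Finset.forall_mem_insert, Finset.exists_mem_insert, not_or] at hA ⊢
    refine (mul_le_mul_of_nonneg_left (ih hA.2) (pr_nonneg _ _)).trans ?_
    refine P.harris_not hA.1 ?_
    rintro ω ω' h ⟨i, hi, hAi⟩
    exact ⟨i, hi, hA.2 i hi h hAi⟩

end Harris
end FinProb

/-! ### Percolation as a finite product, and first-moment bounds for trees. -/

section Percolation
open Finset
open scoped Classical
variable {V : Type*} [Fintype V] [DecidableEq V]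

omit [Fintype V] [DecidableEq V] in
/-- The subgraph of `G` formed by the edges that are open in `ω`. -/
def openSubgraph (G : SimpleGraph V) (ω : Sym2 V → Bool) : SimpleGraph V where
  Adj x y := G.Adj x y ∧ ω s(x, y) = true
  symm := ⟨fun x y h => ⟨h.1.symm, by rw [Sym2.eq_swap]; exact h.2⟩⟩
  loopless := ⟨fun x h => G.loopless.irrefl x h.1⟩

omit [Fintype V] [DecidableEq V] in
theorem mem_edgeSet_openSubgraph {G : SimpleGraph V} {ω : Sym2 V → Bool} {e : Sym2 V} :
    e ∈ (openSubgraph G ω).edgeSet ↔ e ∈ G.edgeSet ∧ ω e = true := by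
  induction e with | _ x y => rfl

omit [Fintype V] [DecidableEq V] in
theorem openSubgraph_eq_fromEdgeSet (G : SimpleGraph V) (ω : Sym2 V → Bool) :
    openSubgraph G ω = SimpleGraph.fromEdgeSet {e | e ∈ G.edgeSet ∧ ω e = true} := by
  ext x y
  simp only [SimpleGraph.fromEdgeSet_adj, Set.mem_ofPred_eq, SimpleGraph.mem_edgeSet]
  exact ⟨fun h => ⟨h, h.1.ne⟩, fun h => h.1⟩

/-- The law of `G_p`, written as a finite product of Bernoulli distributions. -/
theorem percolation_real (G : SimpleGraph V) (p : unitInterval) (A : SimpleGraph V → Prop) :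
    (percolation G p).real {H | A H} =
      (FinProb.pi (Sym2 V) (FinProb.ber p p.2.1 p.2.2)).pr fun ω => A (openSubgraph G ω) := by
  have hm : MeasurableSet {H : SimpleGraph V | A H} := by
    rw [show {H : SimpleGraph V | A H} =
      SimpleGraph.edgeSet ⁻¹' (SimpleGraph.edgeSet '' {H | A H}) from
      (Set.preimage_image_eq _ SimpleGraph.edgeSet_injective).symm]
    exact SimpleGraph.measurableEmbedding_edgeSet.measurable (Set.toFinite _).measurableSet
  rw [percolation, map_measureReal_apply SimpleGraph.measurable_fromEdgeSet hm]
  -- The two laws are compared atom by atom, over the values of the random open edge set.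
  rw [FinProb.pr_eq_sum_fiber _ univ
    (fun ω : Sym2 V → Bool => {e | e ∈ G.edgeSet ∧ ω e = true}) fun _ => mem_univ _]
  set T := SimpleGraph.fromEdgeSet ⁻¹' {H : SimpleGraph V | A H} with hT
  have h1 : (setBernoulli G.edgeSet p).real T =
      ∑ s : Set (Sym2 V), if s ∈ T then (setBernoulli G.edgeSet p).real {s} else 0 := by
    rw [← Finset.sum_filter, sum_measureReal_singleton]
    simp
  rw [h1]
  refine Finset.sum_congr rfl fun s _ => ?_
  by_cases hs : s ∈ T
  · rw [if_pos hs]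
    have hs' : A (SimpleGraph.fromEdgeSet s) := hs
    rw [FinProb.pr_congr (B := fun ω => {e | e ∈ G.edgeSet ∧ ω e = true} = s)]
    swap
    · intro ω
      constructor
      · exact fun h => h.1
      · rintro h
        exact ⟨h, by rw [openSubgraph_eq_fromEdgeSet, h]; exact hs'⟩
    by_cases hsu : s ⊆ G.edgeSet
    · rw [setBernoulli_real_singleton p hsu (Set.toFinite _)]
      rw [FinProb.pr_congr (B := fun ω => ∀ e ∈ (univ.filter fun e => e ∈ G.edgeSet),
        ω e = decide (e ∈ s))]
      · rw [FinProb.pr_pi_forall_mem (s := univ.filter fun e => e ∈ G.edgeSet)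
          (B := fun e b => b = decide (e ∈ s))]
        simp_rw [FinProb.pr_eq, FinProb.ber]
        rw [← Finset.prod_filter_mul_prod_filter_not _ (fun e => e ∈ s)]
        congr 1
        · rw [Finset.prod_congr rfl (g := fun _ => (p : ℝ)), Finset.prod_const, Set.ncard_eq_toFinset_card']
          · congr 2
            ext e; simp; exact fun h => hsu h
          · intro e he; simp at he; simp [he]
        · rw [Finset.prod_congr rfl (g := fun _ => (1 - p : ℝ)), Finset.prod_const, Set.ncard_eq_toFinset_card']
          · congr 2
            ext e; simp
          · intro e he; simp at he; simp [he]
      · intro ω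
        simp only [Set.ext_iff, Set.mem_ofPred_eq, mem_filter, mem_univ, true_and]
        constructor
        · intro h e he
          have := h e
          by_cases hes : e ∈ s <;> simp_all
        · intro h e
          constructor
          · rintro ⟨h1, h2⟩
            have := h e h1
            simp_all
          · intro hes
            exact ⟨hsu hes, by simp [h e (hsu hes), hes]⟩
    · rw [measureReal_def, setBernoulli_singleton_of_not_subset p hsu]
      rw [FinProb.pr_congr (B := fun ω => False), FinProb.pr_false]
      · rfl
      · intro ω
        simp only [iff_false]
        rintro rfl
        exact hsu fun e h => h.1
  · rw [if_neg hs, FinProb.pr_congr (B := fun ω => False), FinProb.pr_false]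
    intro ω
    simp only [iff_false]
    rintro ⟨rfl, h⟩
    exact hs (by rw [openSubgraph_eq_fromEdgeSet] at h; exact h)

/-- `TreeAt v S F`: the edges in `F` form a tree with vertex set `S` containing `v`. -/
inductive TreeAt (v : V) : Finset V → Finset (Sym2 V) → Prop
  | single : TreeAt v {v} ∅
  | grow {S : Finset V} {F : Finset (Sym2 V)} {x w : V} :
      TreeAt v S F → x ∈ S → w ∉ S → TreeAt v (insert w S) (insert s(x, w) F)

/-- The vertex set of the component of `v` in `H`. -/
noncomputable def comp (H : SimpleGraph V) (v : V) : Finset V := univ.filter fun w => H.Reachable v w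

theorem mem_comp {H : SimpleGraph V} {v w : V} : w ∈ comp H v ↔ H.Reachable v w := by simp [comp]

theorem comp_eq_of_mem {H : SimpleGraph V} {v w : V} (h : w ∈ comp H v) : comp H w = comp H v := by
  ext x
  rw [mem_comp] at *
  rw [mem_comp]
  exact ⟨fun hx => h.trans hx, fun hx => h.symm.trans hx⟩

/-- The edges of `G` meeting `S`. -/
noncomputable def touching (G : SimpleGraph V) (S : Finset V) : Finset (Sym2 V) :=
  univ.filter fun e => e ∈ G.edgeSet ∧ ∃ x ∈ S, x ∈ e

/-- The edges of `G` between `S` and its complement. -/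
noncomputable def boundary (G : SimpleGraph V) (S : Finset V) : Finset (Sym2 V) :=
  univ.filter fun e => e ∈ G.edgeSet ∧ (∃ x ∈ S, x ∈ e) ∧ ∃ y ∉ S, y ∈ e

namespace TreeAt
variable {v : V} {S : Finset V} {F : Finset (Sym2 V)}

omit [Fintype V] in
theorem root_mem (h : TreeAt v S F) : v ∈ S := by
  induction h with
  | single => simp
  | grow _ _ _ ih => exact mem_insert_of_mem ih

omit [Fintype V] in
theorem mem_of_mem_edge (h : TreeAt v S F) : ∀ e ∈ F, ∀ y ∈ e, y ∈ S := by
  induction h with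
  | single => simp
  | grow _ hx _ ih =>
    intro e he y hy
    rcases mem_insert.1 he with rfl | he
    · rcases Sym2.mem_iff.1 hy with rfl | rfl
      · exact mem_insert_of_mem hx
      · exact mem_insert_self _ _
    · exact mem_insert_of_mem (ih e he y hy)

omit [Fintype V] in
theorem card_add_one (h : TreeAt v S F) : F.card + 1 = S.card := by
  induction h with
  | single => simp
  | grow h _ hw ih =>
    rw [card_insert_of_notMem hw, card_insert_of_notMem, ih]
    exact fun he => hw (h.mem_of_mem_edge _ he _ (Sym2.mem_mk_right _ _))

omit [Fintype V] in
theorem subset_of_closed (h : TreeAt v S F) {C : Set V} (hv : v ∈ C)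
    (hC : ∀ x y, s(x, y) ∈ F → x ∈ C → y ∈ C) : ∀ x ∈ S, x ∈ C := by
  induction h with
  | single => simpa using hv
  | grow _ hx _ ih =>
    have ih' := ih fun x y he => hC x y (mem_insert_of_mem he)
    intro y hy
    rcases mem_insert.1 hy with rfl | hy
    · exact hC _ _ (mem_insert_self _ _) (ih' _ hx)
    · exact ih' y hy

omit [Fintype V] in
theorem reachable (h : TreeAt v S F) {H : SimpleGraph V} (hF : ∀ e ∈ F, e ∈ H.edgeSet) :
    ∀ x ∈ S, H.Reachable v x :=
  h.subset_of_closed (C := {x | H.Reachable v x}) (SimpleGraph.Reachable.refl _)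
    fun _ _ he hx => SimpleGraph.Reachable.trans hx (SimpleGraph.Adj.reachable (hF _ he))

omit [Fintype V] in
theorem join (h : TreeAt v S F) {w x : V} {S' : Finset V} {F' : Finset (Sym2 V)}
    (h' : TreeAt w S' F') (hd : Disjoint S S') (hx : x ∈ S) :
    TreeAt v (S ∪ S') (insert s(x, w) (F ∪ F')) := by
  induction h' with
  | single =>
    rw [union_comm, ← insert_eq, union_empty]
    exact h.grow hx (by simpa using hd)
  | @grow S' F' y z _ hy hz ih =>
    rw [disjoint_insert_right] at hd
    rw [union_insert, union_insert, insert_comm]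
    refine (ih hd.2).grow (mem_union_right _ hy) ?_
    rw [mem_union]; tauto

/-- A tree in `H` at `v` with the most vertices fills the component, since an edge of `H` leaving it
would extend it. -/
theorem exists_comp (H : SimpleGraph V) (v : V) :
    ∃ F, TreeAt v (comp H v) F ∧ ∀ e ∈ F, e ∈ H.edgeSet := by
  obtain ⟨⟨S, F⟩, hSF, hmax⟩ := Finset.exists_max_image
    (univ.filter fun T : Finset V × Finset (Sym2 V) => TreeAt v T.1 T.2 ∧ ∀ e ∈ T.2, e ∈ H.edgeSet)
    (fun T => T.1.card) ⟨({v}, ∅), by simp [single]⟩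
  simp only [mem_filter, mem_univ, true_and] at hSF hmax
  suffices comp H v = S by rw [this]; exact ⟨F, hSF⟩
  ext y
  rw [mem_comp]
  refine ⟨?_, hSF.1.reachable hSF.2 y⟩
  rintro ⟨p⟩
  have key : ∀ {a b : V}, H.Walk a b → a ∈ S → b ∈ S := by
    intro a b p
    induction p with
    | nil => exact id
    | @cons a b c hab _ ih =>
      intro ha
      refine ih ?_
      by_contra hb
      have := hmax (insert b S, insert s(a, b) F) ⟨hSF.1.grow ha hb, fun e he => by
        rcases mem_insert.1 he with rfl | he
        · exact hab
        · exact hSF.2 e he⟩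
      simp only [card_insert_of_notMem hb] at this
      omega
  exact key p hSF.1.root_mem

end TreeAt

/-- The trees of `G` with `s` vertices that contain `v`. -/
noncomputable def trees (G : SimpleGraph V) (v : V) (s : ℕ) : Finset (Finset V × Finset (Sym2 V)) :=
  univ.filter fun T => TreeAt v T.1 T.2 ∧ T.1.card = s ∧ ∀ e ∈ T.2, e ∈ G.edgeSet

theorem card_touching_le {G : SimpleGraph V} {D : ℕ} (hD : ∀ x, G.degree x ≤ D) (S : Finset V) :
    (touching G S).card ≤ S.card * D := by
  have : touching G S ⊆ S.biUnion fun x => G.incidenceFinset x := by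
    intro e he
    simp only [touching, mem_filter, mem_univ, true_and] at he
    obtain ⟨h1, x, hx, hxe⟩ := he
    simp only [mem_biUnion, SimpleGraph.mem_incidenceFinset]
    exact ⟨x, hx, h1, hxe⟩
  refine (card_le_card this).trans (card_biUnion_le_card_mul _ _ _ fun x _ => ?_)
  rw [SimpleGraph.card_incidenceFinset_eq_degree]
  exact hD x

/-- The number of trees is bounded by percolation with an auxiliary parameter `q`. -/
theorem card_trees_mul_le {G : SimpleGraph V} {D : ℕ} (hD : ∀ x, G.degree x ≤ D) (v : V) (s : ℕ)
    {q : ℝ} (h0 : 0 ≤ q) (h1 : q ≤ 1) :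
    (trees G v s).card * (q ^ (s - 1) * (1 - q) ^ (s * D)) ≤ 1 := by
  set P := FinProb.pi (Sym2 V) (FinProb.ber q h0 h1)
  -- The event for `T` is that, among the edges touching its vertices, exactly those of `T` are
  -- open. Then `T` is the whole open cluster of `v`, so distinct trees give mutually exclusive
  -- events.
  refine le_trans ?_ (P.sum_pr_le_one (trees G v s)
    (fun T ω => ∀ e ∈ touching G T.1, ω e = decide (e ∈ T.2)) ?_)
  · rw [← nsmul_eq_mul]
    refine Finset.card_nsmul_le_sum _ _ _ fun T hT => ?_
    simp only [trees, mem_filter, mem_univ, true_and] at hT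
    obtain ⟨hT, hs, hG⟩ := hT
    rw [FinProb.pr_pi_forall_mem (s := touching G T.1) (B := fun e b => b = decide (e ∈ T.2))]
    simp_rw [FinProb.pr_eq, FinProb.ber]
    rw [← Finset.prod_filter_mul_prod_filter_not _ (fun e => e ∈ T.2)]
    have hsub : (touching G T.1).filter (fun e => e ∈ T.2) = T.2 := by
      ext e
      simp only [touching, mem_filter, mem_univ, true_and]
      refine ⟨fun h => h.2, fun h => ⟨⟨hG e h, ?_⟩, h⟩⟩
      induction e with | _ x y => exact ⟨x, hT.mem_of_mem_edge _ h x (by simp), by simp⟩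
    rw [Finset.prod_congr (s₁ := filter (fun e => e ∈ T.2) (touching G T.1)) rfl (g := fun _ => q),
      Finset.prod_congr (s₁ := filter (fun e => e ∉ T.2) (touching G T.1)) rfl (g := fun _ => 1 - q),
      Finset.prod_const, Finset.prod_const, hsub]
    · have := hT.card_add_one
      rw [show T.2.card = s - 1 by omega]
      refine mul_le_mul_of_nonneg_left (pow_le_pow_of_le_one (by linarith) (by linarith) ?_)
        (pow_nonneg h0 _)
      rw [← hs]
      exact (card_le_card (filter_subset _ _)).trans (card_touching_le hD _)
    · intro e he; simp at he; simp [he]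
    · intro e he; simp at he; simp [he]
  · intro ω T hT T' hT' h h'
    simp only [trees, mem_filter, mem_univ, true_and] at hT hT'
    -- All edges of `T'` are open, so exploring `T'` from `v` can never leave `T`; by symmetry the
    -- trees agree.
    have key : ∀ {T T' : Finset V × Finset (Sym2 V)}, TreeAt v T.1 T.2 → TreeAt v T'.1 T'.2 →
        (∀ e ∈ T'.2, e ∈ G.edgeSet) →
        (∀ e ∈ touching G T.1, ω e = decide (e ∈ T.2)) →
        (∀ e ∈ touching G T'.1, ω e = decide (e ∈ T'.2)) → T'.1 ⊆ T.1 ∧ T'.2 ⊆ T.2 := by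
      intro T T' hT hT' hG' h h'
      have hmem : ∀ e ∈ T'.2, ω e = true := fun e he => by
        rw [h' e]
        · simpa using he
        · simp only [touching, mem_filter, mem_univ, true_and]
          refine ⟨hG' e he, ?_⟩
          induction e with | _ x y => exact ⟨x, hT'.mem_of_mem_edge _ he x (by simp), by simp⟩
      have hin : ∀ x y, s(x, y) ∈ T'.2 → x ∈ T.1 → s(x, y) ∈ T.2 := by
        intro x y he hx
        have := h s(x, y) (by
          simp only [touching, mem_filter, mem_univ, true_and]
          exact ⟨hG' _ he, x, hx, by simp⟩)
        rw [hmem _ he] at this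
        simpa using this.symm
      have hsub : T'.1 ⊆ T.1 := hT'.subset_of_closed (C := {x | x ∈ T.1}) hT.root_mem
        fun x y he hx => hT.mem_of_mem_edge _ (hin x y he hx) y (by simp)
      refine ⟨hsub, fun e he => ?_⟩
      induction e with
      | _ x y => exact hin x y he (hsub (hT'.mem_of_mem_edge _ he x (by simp)))
    have a := key hT.1 hT'.1 hT'.2.2 h h'
    have b := key hT'.1 hT.1 hT.2.2 h' h
    exact Prod.ext (b.1.antisymm a.1) (b.2.antisymm a.2)

/-- Expected number of trees whose edges satisfy `O₂` and no boundary edge of which satisfies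
`O₁`. -/
theorem pr_exists_tree_le {X : Type*} [Fintype X] (P : FinProb X) (O₁ O₂ : X → Prop)
    {G : SimpleGraph V} {D : ℕ} (hD : ∀ x, G.degree x ≤ D) (v : V) (s b : ℕ)
    (hb : ∀ S : Finset V, S.card = s → b ≤ (boundary G S).card)
    {q : ℝ} (h0 : 0 < q) (h1 : q < 1) :
    (FinProb.pi (Sym2 V) P).pr (fun ω => ∃ T ∈ trees G v s, (∀ e ∈ T.2, O₂ (ω e)) ∧
        ∀ e ∈ boundary G T.1, ¬ O₁ (ω e)) ≤
      (P.pr O₂ / q) ^ (s - 1) * (1 - P.pr O₁) ^ b / (1 - q) ^ (s * D) := by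
  have hq : 0 < q ^ (s - 1) * (1 - q) ^ (s * D) :=
    mul_pos (pow_pos h0 _) (pow_pos (by linarith) _)
  have hc : ((trees G v s).card : ℝ) ≤ 1 / (q ^ (s - 1) * (1 - q) ^ (s * D)) := by
    rw [le_div_iff₀ hq]
    exact card_trees_mul_le hD v s h0.le h1.le
  have hp0 := P.pr_nonneg O₁
  have hp1 := P.pr_le_one O₁
  refine (FinProb.pr_exists_le _ _ _).trans ((Finset.sum_le_card_nsmul _ _
    (P.pr O₂ ^ (s - 1) * (1 - P.pr O₁) ^ b) fun T hT => ?_).trans ?_)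
  · simp only [trees, mem_filter, mem_univ, true_and] at hT
    obtain ⟨hT, hs, hG⟩ := hT
    have hdis : Disjoint T.2 (boundary G T.1) := by
      rw [Finset.disjoint_left]
      intro e he hb
      simp only [boundary, mem_filter, mem_univ, true_and] at hb
      obtain ⟨_, _, y, hy, hye⟩ := hb
      exact hy (hT.mem_of_mem_edge e he y hye)
    rw [FinProb.pr_congr (B := fun ω => ∀ e ∈ T.2 ∪ boundary G T.1,
      if e ∈ T.2 then O₂ (ω e) else ¬ O₁ (ω e))]
    · rw [FinProb.pr_pi_forall_mem (s := T.2 ∪ boundary G T.1)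
        (B := fun e x => if e ∈ T.2 then O₂ x else ¬ O₁ x), Finset.prod_union hdis,
        Finset.prod_congr (s₁ := T.2) rfl (g := fun _ => P.pr O₂),
        Finset.prod_congr (s₁ := boundary G T.1) rfl (g := fun _ => 1 - P.pr O₁),
        Finset.prod_const, Finset.prod_const]
      · have := hT.card_add_one
        rw [show T.2.card = s - 1 by omega]
        exact mul_le_mul_of_nonneg_left
          (pow_le_pow_of_le_one (by linarith) (by linarith) (hb _ hs)) (pow_nonneg (P.pr_nonneg _) _)
      · intro e he
        rw [← P.pr_not]
        exact P.pr_congr fun x => by simp [Finset.disjoint_right.1 hdis he]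
      · intro e he
        exact P.pr_congr fun x => by simp [he]
    · intro ω
      constructor
      · rintro ⟨h1, h2⟩ e he
        split_ifs with h
        · exact h1 e h
        · exact h2 e ((mem_union.1 he).resolve_left h)
      · intro h
        refine ⟨fun e he => by simpa [he] using h e (mem_union_left _ he), fun e he => ?_⟩
        simpa [Finset.disjoint_right.1 hdis he] using h e (mem_union_right _ he)
  · rw [nsmul_eq_mul]
    refine (mul_le_mul_of_nonneg_right hc (mul_nonneg (pow_nonneg (P.pr_nonneg _) _)
      (pow_nonneg (by linarith) _))).trans (le_of_eq ?_)
    rw [div_pow]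
    field_simp

end Percolation

/-! ### Edge isoperimetry in the cube. -/

section Cube
open Finset
open scoped Classical
variable {d : ℕ}

/-- Flip one coordinate of a vertex of the cube. -/
def toggle (i : Fin d) (v : Fin d → Bool) : Fin d → Bool := Function.update v i (!v i)

@[simp] theorem toggle_apply_self (i : Fin d) (v : Fin d → Bool) : toggle i v i = !v i := by simp [toggle]

theorem toggle_apply_of_ne {i j : Fin d} (h : j ≠ i) (v : Fin d → Bool) : toggle i v j = v j := by
  simp [toggle, h]

@[simp] theorem toggle_toggle (i : Fin d) (v : Fin d → Bool) : toggle i (toggle i v) = v := by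
  ext j
  by_cases h : j = i
  · subst h; simp
  · rw [toggle_apply_of_ne h, toggle_apply_of_ne h]

theorem toggle_left_injective (v : Fin d → Bool) : Function.Injective fun i => toggle i v := by
  intro i j h
  by_contra hne
  have := congrFun h i
  simp only [toggle_apply_self] at this
  rw [toggle_apply_of_ne hne] at this
  cases hv : v i <;> simp_all

theorem toggle_ne (i : Fin d) (v : Fin d → Bool) : toggle i v ≠ v := by
  intro h
  have := congrFun h i
  simp at this

/-- The graph on the vertices of the cube whose edges have direction in `J`. -/
def dirCube (J : Finset (Fin d)) : SimpleGraph (Fin d → Bool) where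
  Adj x y := ∃ i ∈ J, y = toggle i x
  symm := ⟨fun x y ⟨i, hi, h⟩ => ⟨i, hi, by rw [h, toggle_toggle]⟩⟩
  loopless := ⟨fun x ⟨i, _, h⟩ => toggle_ne i x h.symm⟩

theorem dirCube_adj_toggle {J : Finset (Fin d)} {i : Fin d} (hi : i ∈ J) (x : Fin d → Bool) :
    (dirCube J).Adj x (toggle i x) := ⟨i, hi, rfl⟩

theorem dirCube_mono {J J' : Finset (Fin d)} (h : J ⊆ J') : dirCube J ≤ dirCube J' :=
  fun _ _ ⟨i, hi, e⟩ => ⟨i, h hi, e⟩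

theorem binaryCube_eq_dirCube : binaryCube d = dirCube univ := by
  ext x y
  simp only [binaryCube, dirCube, mem_univ, true_and, hammingDist, card_eq_one]
  constructor
  · rintro ⟨i, hi⟩
    refine ⟨i, ?_⟩
    ext j
    have hj := Finset.ext_iff.1 hi j
    simp only [mem_filter, mem_univ, true_and, mem_singleton] at hj
    by_cases h : j = i
    · subst h
      rw [toggle_apply_self]
      cases hx : x j <;> cases hy : y j <;> simp_all
    · rw [toggle_apply_of_ne h]
      by_contra hne
      exact h (hj.1 (Ne.symm hne))
  · rintro ⟨i, rfl⟩
    refine ⟨i, ?_⟩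
    ext j
    simp only [mem_filter, mem_univ, true_and, mem_singleton]
    by_cases h : j = i
    · subst h; simp
    · simp [toggle_apply_of_ne h, h]

theorem neighborFinset_dirCube (J : Finset (Fin d)) (x : Fin d → Bool)
    [Fintype ((dirCube J).neighborSet x)] :
    (dirCube J).neighborFinset x = J.image fun i => toggle i x := by
  ext y
  rw [SimpleGraph.mem_neighborFinset, mem_image]
  simp only [dirCube]
  exact ⟨fun ⟨i, hi, h⟩ => ⟨i, hi, h.symm⟩, fun ⟨i, hi, h⟩ => ⟨i, hi, h.symm⟩⟩

theorem degree_dirCube (J : Finset (Fin d)) (x : Fin d → Bool)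
    [Fintype ((dirCube J).neighborSet x)] : (dirCube J).degree x = J.card := by
  rw [← SimpleGraph.card_neighborFinset_eq_degree, neighborFinset_dirCube,
    card_image_of_injective _ (toggle_left_injective x)]

theorem degree_dirCube_le (J : Finset (Fin d)) (x : Fin d → Bool)
    [Fintype ((dirCube J).neighborSet x)] : (dirCube J).degree x ≤ d := by
  rw [degree_dirCube]
  simpa using card_le_univ J

/-- Binary entropy is concave, so on `[0, 1/2]` it lies above its chord; the value at `a / (a + b)`
gives the inequality. -/
theorem mul_log_add_mul_log_le {a b : ℝ} (ha : 0 ≤ a) (hab : a ≤ b) :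
    a * Real.log a + b * Real.log b + 2 * a * Real.log 2 ≤ (a + b) * Real.log (a + b) := by
  rcases ha.eq_or_lt with rfl | ha
  · simp
  have hb : 0 < b := ha.trans_le hab
  have h := Real.strictConcave_binEntropy.concaveOn.2 (show (0 : ℝ) ∈ Set.Icc 0 1 by simp)
    (show (2⁻¹ : ℝ) ∈ Set.Icc 0 1 by constructor <;> norm_num)
    (show 0 ≤ (b - a) / (a + b) from div_nonneg (by linarith) (by linarith))
    (show 0 ≤ 2 * a / (a + b) by positivity) (by field_simp; ring)
  simp only [smul_eq_mul, mul_zero, zero_add, Real.binEntropy_zero, Real.binEntropy_two_inv] at h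
  have e : 2 * a / (a + b) * 2⁻¹ = a / (a + b) := by field_simp
  rw [e, Real.binEntropy] at h
  have e2 : 1 - a / (a + b) = b / (a + b) := by field_simp; ring
  rw [e2, inv_div, inv_div, Real.log_div (by positivity) (by positivity),
    Real.log_div (by positivity) (by positivity)] at h
  have h' := mul_le_mul_of_nonneg_left h (a := a + b) (by linarith)
  have e3 : (a + b) * (2 * a / (a + b) * Real.log 2) = 2 * a * Real.log 2 := by field_simp
  have e4 : (a + b) * (a / (a + b) * (Real.log (a + b) - Real.log a) +
      b / (a + b) * (Real.log (a + b) - Real.log b)) =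
      a * (Real.log (a + b) - Real.log a) + b * (Real.log (a + b) - Real.log b) := by
    field_simp
  rw [e3, e4] at h'
  linarith

theorem mul_log_add_mul_log_le_min {a b m : ℝ} (ha : 0 ≤ a) (hb : 0 ≤ b) (hma : m ≤ a)
    (hmb : m ≤ b) :
    a * Real.log a + b * Real.log b + 2 * m * Real.log 2 ≤ (a + b) * Real.log (a + b) := by
  have := Real.log_pos one_lt_two
  rcases le_total a b with h | h
  · have := mul_log_add_mul_log_le ha h
    nlinarith
  · have := mul_log_add_mul_log_le hb h
    rw [add_comm b a] at this
    nlinarith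

/-- The edge-isoperimetric inequality in the cube, counting the edges inside a set twice. -/
theorem sum_card_inner_le (J : Finset (Fin d)) (S : Finset (Fin d → Bool)) :
    ((∑ x ∈ S, (J.filter fun i => toggle i x ∈ S).card : ℕ) : ℝ) * Real.log 2 ≤
      S.card * Real.log S.card := by
  induction J using Finset.induction_on generalizing S with
  | empty =>
    simp only [filter_empty, card_empty, sum_const_zero, Nat.cast_zero, zero_mul]
    exact mul_nonneg (Nat.cast_nonneg _) (Real.log_natCast_nonneg _)
  | insert j J hj ih =>
    set A := S.filter fun x => x j = true with hA
    set B := S.filter fun x => ¬ x j = true with hB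
    have hcard : A.card + B.card = S.card := card_filter_add_card_filter_not _
    -- Cut the cube in direction `j`. Edges with direction in `J` stay inside a half, while
    -- direction `j` gives a matching between the halves, of size at most the smaller one and
    -- counted from both ends.
    have hsplit : ∑ x ∈ S, ((insert j J).filter fun i => toggle i x ∈ S).card =
        ∑ x ∈ A, (J.filter fun i => toggle i x ∈ A).card +
        ∑ x ∈ B, (J.filter fun i => toggle i x ∈ B).card +
        ((A.filter fun x => toggle j x ∈ B).card + (B.filter fun x => toggle j x ∈ A).card) := by
      rw [← sum_filter_add_sum_filter_not S fun x => x j = true]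
      rw [← hA, ← hB, card_filter, card_filter, add_add_add_comm, ← sum_add_distrib,
        ← sum_add_distrib]
      congr 1
      · refine sum_congr rfl fun x hx => ?_
        rw [filter_insert]
        have hx' := (mem_filter.1 hx).2
        have e1 : toggle j x ∈ B ↔ toggle j x ∈ S := by simp [hB, hx']
        have e2 : (J.filter fun i => toggle i x ∈ S) = J.filter fun i => toggle i x ∈ A :=
          filter_congr fun i hi => by
            have : j ≠ i := by rintro rfl; exact hj hi
            simp [hA, toggle_apply_of_ne this, hx']
        rw [e2]
        by_cases h : toggle j x ∈ S
        · simp [h, e1, hj]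
        · simp [h, e1]
      · refine sum_congr rfl fun x hx => ?_
        rw [filter_insert]
        have hx' := (mem_filter.1 hx).2
        have e1 : toggle j x ∈ A ↔ toggle j x ∈ S := by simp [hA, hx']
        have e2 : (J.filter fun i => toggle i x ∈ S) = J.filter fun i => toggle i x ∈ B :=
          filter_congr fun i hi => by
            have : j ≠ i := by rintro rfl; exact hj hi
            simp only [hB, mem_filter, toggle_apply_of_ne this]; tauto
        rw [e2]
        by_cases h : toggle j x ∈ S
        · simp [h, e1, hj]
        · simp [h, e1]
    have hinj : Function.Injective (toggle j) := fun x y h => by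
      rw [← toggle_toggle j x, h, toggle_toggle]
    have hAB : (B.filter fun x => toggle j x ∈ A).card = (A.filter fun x => toggle j x ∈ B).card := by
      refine card_bij (fun x _ => toggle j x) ?_ (fun x _ y _ h => hinj h) ?_
      · intro x hx
        simp only [mem_filter] at hx ⊢
        simp [hx]
      · intro x hx
        simp only [mem_filter] at hx
        exact ⟨toggle j x, by simp [hx], by simp⟩
    have hm1 : (A.filter fun x => toggle j x ∈ B).card ≤ A.card := card_le_card (filter_subset _ _)
    have hm2 : (A.filter fun x => toggle j x ∈ B).card ≤ B.card := by
      rw [← hAB]; exact card_le_card (filter_subset _ _)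
    rw [hsplit, hAB]
    have := mul_log_add_mul_log_le_min (a := A.card) (b := B.card)
      (m := (A.filter fun x => toggle j x ∈ B).card) (by positivity) (by positivity)
      (by exact_mod_cast hm1) (by exact_mod_cast hm2)
    have i1 := ih A
    have i2 := ih B
    rw [← hcard]
    push_cast at i1 i2 ⊢
    linarith

theorem sum_card_outer_le (J : Finset (Fin d)) (S : Finset (Fin d → Bool)) :
    ∑ x ∈ S, (J.filter fun i => toggle i x ∉ S).card ≤ (boundary (dirCube J) S).card := by
  rw [← card_sigma]
  refine card_le_card_of_injOn (fun z => s(z.1, toggle z.2 z.1)) ?_ ?_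
  · rintro ⟨x, i⟩ h
    simp only [coe_sigma, Set.mem_sigma_iff, mem_coe, mem_filter] at h
    simp only [boundary, coe_filter, mem_univ, true_and, Set.mem_ofPred_eq]
    exact ⟨dirCube_adj_toggle h.2.1 x, ⟨x, h.1, by simp⟩, ⟨toggle i x, h.2.2, by simp⟩⟩
  · rintro ⟨x, i⟩ h ⟨y, j⟩ h' e
    simp only [coe_sigma, Set.mem_sigma_iff, mem_coe, mem_filter] at h h'
    simp only [Sym2.eq_iff] at e
    rcases e with ⟨rfl, e⟩ | ⟨e, -⟩
    · have := toggle_left_injective x e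
      simp [this]
    · exact absurd h.1 (by rw [e]; exact h'.2.2)

/-- Edge expansion of sets with at most `2 ^ a` vertices. -/
theorem card_mul_le_card_boundary (J : Finset (Fin d)) {S : Finset (Fin d → Bool)} {a : ℕ}
    (hS : S.card ≤ 2 ^ a) : S.card * (J.card - a) ≤ (boundary (dirCube J) S).card := by
  refine le_trans ?_ (sum_card_outer_le J S)
  rcases S.eq_empty_or_nonempty with rfl | hne
  · simp
  have h := sum_card_inner_le J S
  have hlog : Real.log S.card ≤ a * Real.log 2 := by
    rw [← Real.log_pow]
    exact Real.log_le_log (by exact_mod_cast hne.card_pos) (by exact_mod_cast hS)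
  have h2 := Real.log_pos one_lt_two
  have h3 : ∑ x ∈ S, (J.filter fun i => toggle i x ∈ S).card ≤ S.card * a := by
    have : ((∑ x ∈ S, (J.filter fun i => toggle i x ∈ S).card : ℕ) : ℝ) * Real.log 2 ≤
        ((S.card * a : ℕ) : ℝ) * Real.log 2 := by
      refine h.trans ?_
      push_cast
      rw [mul_assoc]
      exact mul_le_mul_of_nonneg_left hlog (Nat.cast_nonneg _)
    exact_mod_cast le_of_mul_le_mul_right this h2
  have h4 : ∑ x ∈ S, (J.filter fun i => toggle i x ∈ S).card +
      ∑ x ∈ S, (J.filter fun i => toggle i x ∉ S).card = S.card * J.card := by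
    rw [← sum_add_distrib, sum_congr rfl fun x _ => card_filter_add_card_filter_not _, sum_const,
      smul_eq_mul]
  rw [Nat.mul_sub]
  omega

end Cube

/-! ### Long paths and the upper branching bound. -/

section Paths
open Finset
open scoped Classical

/-- There is a path of `k` edges in `H` that starts at `v` and avoids `A`. -/
def LongPath {V : Type*} [DecidableEq V] (H : SimpleGraph V) : ℕ → Finset V → V → Prop
  | 0, _, _ => True
  | k + 1, A, v => ∃ w, w ∉ A ∧ H.Adj v w ∧ LongPath H k (insert v A) w

section general
variable {V : Type*} [Fintype V] [DecidableEq V]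

theorem LongPath.exists_finset {H : SimpleGraph V} {k : ℕ} {A : Finset V} {v : V}
    (h : LongPath H k A v) (hv : v ∉ A) : ∃ T ⊆ comp H v, Disjoint T A ∧ T.card = k + 1 := by
  induction k generalizing A v with
  | zero => exact ⟨{v}, by simp [mem_comp], by simpa using hv, by simp⟩
  | succ k ih =>
    obtain ⟨w, hwA, hvw, hw⟩ := h
    obtain ⟨T, hT, hd, hc⟩ := ih hw (by simp [hwA, hvw.ne'])
    rw [disjoint_insert_right] at hd
    refine ⟨insert v T, ?_, ?_, ?_⟩
    · rw [insert_subset_iff, comp_eq_of_mem (mem_comp.2 hvw.symm.reachable)]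
      exact ⟨mem_comp.2 hvw.symm.reachable, hT⟩
    · rw [disjoint_insert_left]; exact ⟨hv, hd.2⟩
    · rw [card_insert_of_notMem hd.1, hc]

theorem LongPath.lt_card_comp {H : SimpleGraph V} {k : ℕ} {v : V} (h : LongPath H k ∅ v) :
    k < (comp H v).card := by
  obtain ⟨T, hT, -, hc⟩ := h.exists_finset (by simp)
  have := card_le_card hT
  omega

omit [Fintype V] in
theorem LongPath.mono {H H' : SimpleGraph V} (hH : H ≤ H') {k : ℕ} {A : Finset V} {v : V}
    (h : LongPath H k A v) : LongPath H' k A v := by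
  induction k generalizing A v with
  | zero => trivial
  | succ k ih =>
    obtain ⟨w, hwA, hvw, hw⟩ := h
    exact ⟨w, hwA, hH hvw, ih hw⟩

omit [Fintype V] in
theorem longPath_of_walk {H : SimpleGraph V} {v w : V} (p : H.Walk v w) (hp : p.IsPath) {k : ℕ}
    (hk : k ≤ p.length) {A : Finset V} (hA : ∀ x ∈ p.support, x ∉ A) : LongPath H k A v := by
  induction p generalizing k A with
  | nil =>
    obtain rfl : k = 0 := by simpa using hk
    trivial
  | @cons a b c hab q ih =>
    cases k with
    | zero => trivial
    | succ k =>
      rw [SimpleGraph.Walk.cons_isPath_iff] at hp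
      simp only [SimpleGraph.Walk.length_cons, add_le_add_iff_right] at hk
      simp only [SimpleGraph.Walk.support_cons, List.mem_cons, forall_eq_or_imp] at hA
      refine ⟨b, hA.2 b q.start_mem_support, hab, ih hp.1 hk fun x hx => ?_⟩
      rw [mem_insert, not_or]
      exact ⟨by rintro rfl; exact hp.2 hx, hA.2 x hx⟩

omit [Fintype V] [DecidableEq V] in
theorem openSubgraph_le (G : SimpleGraph V) (ω : Sym2 V → Bool) : openSubgraph G ω ≤ G :=
  fun _ _ h => h.1

omit [Fintype V] [DecidableEq V] in
theorem openSubgraph_mono {G G' : SimpleGraph V} (hG : G ≤ G') {ω ω' : Sym2 V → Bool}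
    (h : ω ≤ ω') : openSubgraph G ω ≤ openSubgraph G' ω' :=
  fun x y hxy => ⟨hG hxy.1, by have := h s(x, y); rw [hxy.2] at this; exact top_le_iff.1 this⟩

-- A path avoiding `A` uses no edge at `A`, so after its first edge the continuation is independent
-- of that edge.
omit [Fintype V] in
theorem dependsOn_longPath_avoid (G : SimpleGraph V) (k : ℕ) {A : Finset V} {v : V} (hv : v ∉ A) :
    DependsOn (fun ω => LongPath (openSubgraph G ω) k A v) {e | ∀ x ∈ e, x ∉ A} := by
  intro ω ω' h
  induction k generalizing A v with
  | zero => rfl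
  | succ k ih =>
    refine propext (exists_congr fun w => and_congr_right fun hwA => ?_)
    by_cases hG : G.Adj v w
    · have e : ω s(v, w) = ω' s(v, w) := h _ fun x hx => by
        rcases Sym2.mem_iff.1 hx with rfl | rfl <;> assumption
      simp only [openSubgraph, e]
      refine and_congr_right fun _ => (ih (A := insert v A) (v := w) ?_ fun e he => h e ?_).to_iff
      · simp [hwA, hG.ne']
      · exact fun x hx hxA => he x hx (mem_insert_of_mem hxA)
    · simp [openSubgraph, hG]

/-- Upper bound by the recursion for branching processes. -/
noncomputable def pathBound (p : ℝ) (D : ℕ) : ℕ → ℝ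
  | 0 => 1
  | k + 1 => 1 - (1 - p * pathBound p D k) ^ D

theorem pathBound_mem {p : ℝ} (h0 : 0 ≤ p) (h1 : p ≤ 1) (D k : ℕ) :
    0 ≤ pathBound p D k ∧ pathBound p D k ≤ 1 := by
  induction k with
  | zero => simp [pathBound]
  | succ k ih =>
    have a : 0 ≤ 1 - p * pathBound p D k := by nlinarith
    have b : 1 - p * pathBound p D k ≤ 1 := by nlinarith
    have := pow_nonneg a D
    have := pow_le_one₀ a b (n := D)
    constructor <;> simp only [pathBound] <;> linarith

theorem pr_coord {ι X : Type*} [Fintype ι] [DecidableEq ι] [Fintype X] (P : FinProb X) (e : ι)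
    (B : X → Prop) : (FinProb.pi ι P).pr (fun ω => B (ω e)) = P.pr B := by
  have := P.pr_pi_forall_mem {e} fun _ => B
  simpa using this

theorem dependsOn_coord {ι X : Type*} (e : ι) (B : X → Prop) :
    DependsOn (fun ω : ι → X => B (ω e)) {e} := fun ω ω' h => by
  simp only [h e rfl]

theorem pr_ber {p : ℝ} (h0 : 0 ≤ p) (h1 : p ≤ 1) : (FinProb.ber p h0 h1).pr (fun b => b = true) = p := by
  rw [FinProb.pr_eq]; simp [FinProb.ber]

/-- A path starts through one of at most `D` neighbours. For each neighbour the first edge is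
independent of the continuation, which avoids `v`; the resulting increasing events are combined by
`harris_exists`. -/
theorem pr_longPath_le {G : SimpleGraph V} {D : ℕ} (hD : ∀ x, G.degree x ≤ D) {p : ℝ} (h0 : 0 ≤ p)
    (h1 : p ≤ 1) (k : ℕ) {A : Finset V} {v : V} (hv : v ∉ A) :
    (FinProb.pi (Sym2 V) (FinProb.ber p h0 h1)).pr
      (fun ω => LongPath (openSubgraph G ω) k A v) ≤ pathBound p D k := by
  set P := FinProb.pi (Sym2 V) (FinProb.ber p h0 h1)
  induction k generalizing A v with
  | zero => exact P.pr_le_one _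
  | succ k ih =>
    set s := (G.neighborFinset v).filter fun w => w ∉ A with hs
    have hu := pathBound_mem h0 h1 D k
    have hcard : s.card ≤ D := (card_le_card (filter_subset _ _)).trans (hD v)
    have heq : P.pr (fun ω => LongPath (openSubgraph G ω) (k + 1) A v) =
        P.pr (fun ω => ∃ w ∈ s, ω s(v, w) = true ∧
          LongPath (openSubgraph G ω) k (insert v A) w) := by
      refine P.pr_congr fun ω => ?_
      simp only [LongPath, openSubgraph, hs, mem_filter, SimpleGraph.mem_neighborFinset]
      exact exists_congr fun w => by tauto
    have hH := FinProb.harris_exists (FinProb.ber p h0 h1) s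
      (A := fun w ω => ω s(v, w) = true ∧ LongPath (openSubgraph G ω) k (insert v A) w) (by
        rintro w - ω ω' h ⟨h1, h2⟩
        refine ⟨?_, h2.mono (openSubgraph_mono le_rfl h)⟩
        have := h s(v, w)
        rw [h1] at this
        exact top_le_iff.1 this)
    have hprod : (1 - p * pathBound p D k) ^ D ≤ ∏ w ∈ s, (1 - P.pr (fun ω => ω s(v, w) = true ∧
        LongPath (openSubgraph G ω) k (insert v A) w)) := by
      have a : 0 ≤ 1 - p * pathBound p D k := by nlinarith
      have b : 1 - p * pathBound p D k ≤ 1 := by nlinarith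
      refine (pow_le_pow_of_le_one a b hcard).trans ?_
      rw [← prod_const]
      refine prod_le_prod (fun _ _ => a) fun w hw => ?_
      simp only [hs, mem_filter, SimpleGraph.mem_neighborFinset] at hw
      have hwA : w ∉ insert v A := by simp [hw.2, hw.1.ne']
      rw [FinProb.pr_pi_and _ (dependsOn_coord s(v, w) fun b => b = true)
        (dependsOn_longPath_avoid G k hwA)]
      · rw [pr_coord _ _ fun b => b = true, pr_ber]
        have := mul_le_mul_of_nonneg_left (ih hwA) h0
        linarith
      · rw [Set.disjoint_singleton_left]
        intro h
        exact h v (by simp) (by simp)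
    rw [heq, pathBound]
    linarith

end general

variable {d : ℕ}

theorem hammingDist_of_adj {J : Finset (Fin d)} {x y : Fin d → Bool} (h : (dirCube J).Adj x y) :
    hammingDist x y = 1 := by
  have : (binaryCube d).Adj x y := by
    rw [binaryCube_eq_dirCube]; exact dirCube_mono (subset_univ J) h
  exact this

theorem card_hammingBall_le (v : Fin d → Bool) (r : ℕ) :
    (univ.filter fun w => hammingDist v w ≤ r).card ≤ (d + 1) ^ r := by
  induction r with
  | zero =>
    simp only [nonpos_iff_eq_zero, hammingDist_eq_zero, pow_zero]
    rw [card_le_one]; simp +contextual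
  | succ r ih =>
    have hsub : (univ.filter fun w => hammingDist v w ≤ r + 1) ⊆
        (univ.filter fun w => hammingDist v w ≤ r).biUnion
          fun w => insert w (univ.image fun i => toggle i w) := by
      intro w hw
      simp only [mem_filter, mem_univ, true_and] at hw
      simp only [mem_biUnion, mem_filter, mem_univ, true_and, mem_insert, mem_image]
      by_cases h : hammingDist v w ≤ r
      · exact ⟨w, h, Or.inl rfl⟩
      · have hpos : hammingDist v w ≠ 0 := by omega
        rw [Ne, hammingDist_eq_zero] at hpos
        obtain ⟨i, hi⟩ := Function.ne_iff.1 hpos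
        refine ⟨toggle i w, ?_, Or.inr ⟨i, by simp⟩⟩
        have : (univ.filter fun j => v j ≠ toggle i w j) ⊆
            (univ.filter fun j => v j ≠ w j).erase i := by
          intro j hj
          simp only [mem_filter, mem_univ, true_and, mem_erase] at hj ⊢
          by_cases hji : j = i
          · subst hji
            rw [toggle_apply_self] at hj
            cases hv : v j <;> cases hw : w j <;> simp_all
          · rw [toggle_apply_of_ne hji] at hj
            exact ⟨hji, hj⟩
        have h2 := card_le_card this
        rw [card_erase_of_mem (by simpa using hi)] at h2
        have e1 : hammingDist v w = (univ.filter fun j => v j ≠ w j).card := by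
          simp [hammingDist]
        have e2 : hammingDist v (toggle i w) = (univ.filter fun j => v j ≠ toggle i w j).card := by
          simp [hammingDist]
        omega
    refine (card_le_card hsub).trans ((card_biUnion_le_card_mul _ _ (d + 1) fun w _ => ?_).trans ?_)
    · refine (card_insert_le _ _).trans (Nat.add_le_add_right (card_image_le.trans ?_) 1)
      simp
    · rw [pow_succ]; exact Nat.mul_le_mul_right _ ih

theorem hammingDist_le_length {J : Finset (Fin d)} {H : SimpleGraph (Fin d → Bool)}
    (hH : H ≤ dirCube J) {v w : Fin d → Bool} (p : H.Walk v w) : hammingDist v w ≤ p.length := by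
  induction p with
  | nil => simp
  | @cons a b c hab q ih =>
    rw [SimpleGraph.Walk.length_cons]
    have := hammingDist_triangle a b c
    have := hammingDist_of_adj (hH hab)
    omega

/-- The component does not fit in a Hamming ball of radius `k`, and a path to a vertex outside the
ball has more than `k` edges. -/
theorem longPath_of_card_comp {J : Finset (Fin d)} {H : SimpleGraph (Fin d → Bool)}
    (hH : H ≤ dirCube J) {v : Fin d → Bool} {k : ℕ} (hk : (d + 1) ^ k < (comp H v).card) :
    LongPath H k ∅ v := by
  have : ¬ comp H v ⊆ univ.filter fun w => hammingDist v w ≤ k := fun h =>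
    absurd ((card_le_card h).trans (card_hammingBall_le v k)) (by omega)
  obtain ⟨w, hw, hwk⟩ := not_subset.1 this
  simp only [mem_filter, mem_univ, true_and, not_le] at hwk
  obtain ⟨p⟩ := mem_comp.1 hw
  have := hammingDist_le_length hH p.bypass
  exact longPath_of_walk p.bypass p.bypass_isPath (by omega) (by simp)

theorem dependsOn_longPath_ball (J : Finset (Fin d)) (k : ℕ) (A : Finset (Fin d → Bool))
    (v : Fin d → Bool) :
    DependsOn (fun ω => LongPath (openSubgraph (dirCube J) ω) k A v)
      {e | ∀ x ∈ e, hammingDist v x ≤ k} := by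
  intro ω ω' h
  induction k generalizing A v with
  | zero => rfl
  | succ k ih =>
    refine propext (exists_congr fun w => and_congr_right fun hwA => ?_)
    by_cases hG : (dirCube J).Adj v w
    · have hd := hammingDist_of_adj hG
      have e : ω s(v, w) = ω' s(v, w) := h _ fun x hx => by
        rcases Sym2.mem_iff.1 hx with rfl | rfl
        · simp
        · omega
      simp only [openSubgraph, e]
      refine and_congr_right fun _ => (ih (insert v A) w fun e he => h e ?_).to_iff
      intro x hx
      have := he x hx
      have := hammingDist_triangle v w x
      omega
    · simp [openSubgraph, hG]

/-- There is an open path of `k` edges from `v` whose edges have distinct directions in `J`. -/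
def GeoPath (ω : Sym2 (Fin d → Bool) → Bool) : ℕ → Finset (Fin d) → (Fin d → Bool) → Prop
  | 0, _, _ => True
  | k + 1, J, v => ∃ i ∈ J, ω s(v, toggle i v) = true ∧ GeoPath ω k (J.erase i) (toggle i v)

/-- The subcube through `v` with directions `J`. -/
def cell (J : Finset (Fin d)) (v : Fin d → Bool) : Set (Fin d → Bool) := {x | ∀ i ∉ J, x i = v i}

theorem self_mem_cell (J : Finset (Fin d)) (v : Fin d → Bool) : v ∈ cell J v := fun _ _ => rfl

theorem toggle_mem_cell {J : Finset (Fin d)} {v x : Fin d → Bool} {i : Fin d} (hi : i ∈ J)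
    (hx : x ∈ cell J v) : toggle i x ∈ cell J v := fun j hj => by
  rw [toggle_apply_of_ne (by rintro rfl; exact hj hi)]; exact hx j hj

/-- The edges with both ends in `C`. -/
def edgesIn {V : Type*} (C : Set V) : Set (Sym2 V) := {e | ∀ x ∈ e, x ∈ C}

theorem edgesIn_mono {V : Type*} {C C' : Set V} (h : C ⊆ C') : edgesIn C ⊆ edgesIn C' :=
  fun _ he x hx => h (he x hx)

theorem edgesIn_disjoint {V : Type*} {C C' : Set V} (h : Disjoint C C') :
    Disjoint (edgesIn C) (edgesIn C') := by
  rw [Set.disjoint_left] at *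
  intro e
  induction e with | _ x y => exact fun h1 h2 => h (h1 x (by simp)) (h2 x (by simp))

theorem GeoPath.mono {ω : Sym2 (Fin d → Bool) → Bool} {k : ℕ} {J J' : Finset (Fin d)}
    {v : Fin d → Bool} (hJ : J ⊆ J') (h : GeoPath ω k J v) : GeoPath ω k J' v := by
  induction k generalizing J J' v with
  | zero => trivial
  | succ k ih =>
    obtain ⟨i, hi, ho, hp⟩ := h
    exact ⟨i, hJ hi, ho, ih (erase_subset_erase i hJ) hp⟩

/-- No direction is used twice, so every earlier vertex differs from the current one in a coordinate
that will not change again. -/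
theorem GeoPath.longPath {ω : Sym2 (Fin d → Bool) → Bool} {k : ℕ} {J J₀ : Finset (Fin d)}
    {v : Fin d → Bool} (h : GeoPath ω k J v) (hJ : J ⊆ J₀) {A : Finset (Fin d → Bool)}
    (hA : ∀ a ∈ A, ∃ j ∉ J, a j ≠ v j) : LongPath (openSubgraph (dirCube J₀) ω) k A v := by
  induction k generalizing J v A with
  | zero => trivial
  | succ k ih =>
    obtain ⟨i, hi, ho, hp⟩ := h
    refine ⟨toggle i v, fun hm => ?_, ⟨dirCube_adj_toggle (hJ hi) v, ho⟩,
      ih hp ((erase_subset _ _).trans hJ) fun a ha => ?_⟩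
    · obtain ⟨j, hj, hne⟩ := hA _ hm
      exact hne (toggle_apply_of_ne (by rintro rfl; exact hj hi) v)
    · rcases mem_insert.1 ha with rfl | ha
      · refine ⟨i, by simp, ?_⟩
        rw [toggle_apply_self]; cases a i <;> simp
      · obtain ⟨j, hj, hne⟩ := hA a ha
        refine ⟨j, fun h => hj (mem_of_mem_erase h), ?_⟩
        rwa [toggle_apply_of_ne (by rintro rfl; exact hj hi)]

theorem dependsOn_geoPath (k : ℕ) (J : Finset (Fin d)) (v : Fin d → Bool) :
    DependsOn (fun ω => GeoPath ω k J v) (edgesIn (cell J v)) := by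
  intro ω ω' h
  induction k generalizing J v with
  | zero => rfl
  | succ k ih =>
    refine propext (exists_congr fun i => and_congr_right fun hi => ?_)
    have h1 : ω s(v, toggle i v) = ω' s(v, toggle i v) := h _ fun x hx => by
      rcases Sym2.mem_iff.1 hx with rfl | rfl
      · exact self_mem_cell _ _
      · exact toggle_mem_cell hi (self_mem_cell _ _)
    rw [h1]
    refine and_congr_right fun _ => (ih (J.erase i) (toggle i v) fun e he => h e ?_).to_iff
    refine edgesIn_mono (fun x hx j hj => ?_) he
    rw [hx j fun h => hj (mem_of_mem_erase h), toggle_apply_of_ne (by rintro rfl; exact hj hi)]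

end Paths

/-! ### The lower branching bound and the limiting survival probability. -/

section Branching
open Finset
open scoped Classical
variable {d : ℕ}

theorem cell_toggle_disjoint {J I : Finset (Fin d)} {i j : Fin d} (hi : i ∈ I)
    (hij : i ≠ j) (v : Fin d → Bool) :
    Disjoint (cell (J \ I) (toggle i v)) (cell (J \ I) (toggle j v)) := by
  rw [Set.disjoint_left]
  intro x hx hx'
  have h1 := hx i (by simp [hi])
  have h2 := hx' i (by simp [hi])
  rw [toggle_apply_self] at h1
  rw [toggle_apply_of_ne hij] at h2
  rw [h1] at h2
  cases hv : v i <;> simp_all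

/-- Condition on the set `I` of open directions at `v`. If the paths continue only in directions of
`J \ I`, they live in disjoint subcubes that miss `v`, so they are independent of one another and of
the edges at `v`. At most `M` directions are lost unless `|I| > M`, which costs the Markov term. -/
theorem le_pr_geoPath_succ {p : ℝ} (h0 : 0 ≤ p) (h1 : p ≤ 1) {r : ℝ} (hr1 : r ≤ 1)
    (k M : ℕ) (J : Finset (Fin d)) (v : Fin d → Bool)
    (h : ∀ w, ∀ J' : Finset (Fin d), J.card ≤ J'.card + M →
      r ≤ (FinProb.pi (Sym2 (Fin d → Bool)) (FinProb.ber p h0 h1)).pr fun ω => GeoPath ω k J' w) :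
    1 - (1 - p * r) ^ J.card - p * J.card / (M + 1) ≤
      (FinProb.pi (Sym2 (Fin d → Bool)) (FinProb.ber p h0 h1)).pr
        fun ω => GeoPath ω (k + 1) J v := by
  set P := FinProb.pi (Sym2 (Fin d → Bool)) (FinProb.ber p h0 h1) with hP
  set N : (Sym2 (Fin d → Bool) → Bool) → Finset (Fin d) :=
    fun ω => J.filter fun i => ω s(v, toggle i v) = true with hN
  have hNp : ∀ ω, N ω ∈ J.powerset := fun ω => by simp [hN]
  have hinj : ∀ i j : Fin d, s(v, toggle i v) = s(v, toggle j v) → i = j := fun i j hij => by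
    rw [Sym2.eq_iff] at hij
    rcases hij with ⟨-, h⟩ | ⟨h, -⟩
    · exact toggle_left_injective v h
    · exact absurd h.symm (toggle_ne j v)
  have hfew : P.pr (fun ω => ¬ GeoPath ω (k + 1) J v ∧ (N ω).card ≤ M) ≤ (1 - p * r) ^ J.card := by
    rw [P.pr_eq_sum_fiber J.powerset N hNp]
    have hterm : ∀ I ∈ J.powerset, P.pr (fun ω => N ω = I ∧ ¬ GeoPath ω (k + 1) J v ∧
        (N ω).card ≤ M) ≤ (∏ i ∈ I, p * (1 - r)) * ∏ i ∈ J \ I, (1 - p) := by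
      intro I hI
      rw [mem_powerset] at hI
      have hpos : 0 ≤ (∏ i ∈ I, p * (1 - r)) * ∏ i ∈ J \ I, (1 - p) :=
        mul_nonneg (prod_nonneg fun _ _ => mul_nonneg h0 (by linarith))
          (prod_nonneg fun _ _ => by linarith)
      by_cases hM : I.card ≤ M
      swap
      · rw [FinProb.pr_congr (B := fun ω => False), FinProb.pr_false]
        · exact hpos
        · intro ω
          simp only [iff_false]
          rintro ⟨rfl, -, h⟩
          exact hM h
      have hopen : P.pr (fun ω => ∀ i ∈ J, ω s(v, toggle i v) = decide (i ∈ I)) =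
          (∏ i ∈ I, p) * ∏ i ∈ J \ I, (1 - p) := by
        rw [hP, FinProb.pr_pi_forall_dependsOn _ J
          (A := fun i ω => ω s(v, toggle i v) = decide (i ∈ I))
          (I := fun i => {s(v, toggle i v)}) (fun i _ => dependsOn_coord _ fun b => b = decide (i ∈ I))]
        · rw [← prod_sdiff hI, mul_comm]
          congr 1
          · refine prod_congr rfl fun i hi => ?_
            rw [pr_coord _ _ fun b => b = decide (i ∈ I), FinProb.pr_eq]
            simp [FinProb.ber, hi]
          · refine prod_congr rfl fun i hi => ?_
            rw [Finset.mem_sdiff] at hi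
            rw [pr_coord _ _ fun b => b = decide (i ∈ I), FinProb.pr_eq]
            simp [FinProb.ber, hi.2]
        · intro i _ j _ hij
          rw [Set.disjoint_singleton]
          exact fun h => hij (hinj i j h)
      have hnot : P.pr (fun ω => ∀ i ∈ I, ¬ GeoPath ω k (J \ I) (toggle i v)) ≤
          ∏ i ∈ I, (1 - r) := by
        rw [hP, FinProb.pr_pi_forall_dependsOn _ I
          (A := fun i ω => ¬ GeoPath ω k (J \ I) (toggle i v))
          (I := fun i => edgesIn (cell (J \ I) (toggle i v)))]
        · refine prod_le_prod (fun _ _ => FinProb.pr_nonneg _ _) fun i hi => ?_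
          rw [FinProb.pr_not]
          have := h (toggle i v) (J \ I) (by rw [card_sdiff_of_subset hI]; omega)
          linarith
        · intro i _ ω ω' hω
          exact congrArg Not (dependsOn_geoPath k (J \ I) (toggle i v) hω)
        · intro i hi j hj hij
          exact edgesIn_disjoint (cell_toggle_disjoint hi hij v)
      have hand := FinProb.pr_pi_and (FinProb.ber p h0 h1)
        (A := fun ω : Sym2 (Fin d → Bool) → Bool =>
          ∀ i ∈ J, ω s(v, toggle i v) = decide (i ∈ I))
        (B := fun ω => ∀ i ∈ I, ¬ GeoPath ω k (J \ I) (toggle i v))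
        (I := {e | v ∈ e}) (J := {e | v ∉ e}) ?_ ?_ ?_
      · rw [prod_mul_distrib, mul_right_comm, ← hopen]
        refine le_trans ?_ (hand.le.trans (mul_le_mul_of_nonneg_left hnot (FinProb.pr_nonneg _ _)))
        refine P.pr_mono fun ω => ?_
        rintro ⟨hNI, hg, -⟩
        refine ⟨fun i hi => ?_, fun i hi hgi => hg ⟨i, hI hi, ?_, hgi.mono fun j hj => ?_⟩⟩
        · have : i ∈ N ω ↔ i ∈ I := by rw [hNI]
          simp only [hN, mem_filter, hi, true_and] at this
          cases hω : ω s(v, toggle i v) <;> rw [hω] at this <;> simpa using this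
        · rw [← hNI] at hi
          exact (mem_filter.1 hi).2
        · rw [Finset.mem_sdiff] at hj
          rw [mem_erase]
          exact ⟨by rintro rfl; exact hj.2 hi, hj.1⟩
      · intro ω ω' hω
        refine propext (forall₂_congr fun i hi => ?_)
        rw [hω _ (show s(v, toggle i v) ∈ {e | v ∈ e} by simp)]
      · intro ω ω' hω
        refine propext (forall₂_congr fun i hi => not_congr ?_)
        refine (dependsOn_geoPath k (J \ I) (toggle i v) fun e he => hω e fun hv => ?_).to_iff
        have := he v hv i (by simp [hi])
        rw [toggle_apply_self] at this
        exact Bool.not_ne_self _ this.symm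
      · rw [Set.disjoint_left]
        exact fun e h h' => h' h
    refine (sum_le_sum hterm).trans_eq ?_
    -- The sum over `I ⊆ J` is the expansion of `(p (1 - r) + (1 - p)) ^ |J|`.
    rw [← prod_add, prod_const]
    congr 1; ring
  have hmany : P.pr (fun ω => (M + 1 : ℝ) ≤ (N ω).card) ≤ p * J.card / (M + 1) := by
    rw [le_div_iff₀ (by positivity), mul_comm]
    refine (P.markov (f := fun ω => ((N ω).card : ℝ)) (fun ω => Nat.cast_nonneg _) _).trans_eq ?_
    have := P.ex_count J fun i ω => ω s(v, toggle i v) = true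
    rw [sum_congr rfl (g := fun _ => p), sum_const, nsmul_eq_mul, mul_comm] at this
    · rw [← this]
      congr 1; ext ω
      rw [FinProb.count, hN]
      congr!
    intro i _
    rw [hP, pr_coord _ _ fun b => b = true, pr_ber]
  have hsplit : P.pr (fun ω => ¬ GeoPath ω (k + 1) J v) ≤ (1 - p * r) ^ J.card +
      p * J.card / (M + 1) := by
    refine (P.pr_mono fun ω hω => ?_).trans ((P.pr_or_le _ _).trans (add_le_add hfew hmany))
    by_cases hM : (N ω).card ≤ M
    · exact Or.inl ⟨hω, hM⟩
    · right
      exact_mod_cast not_le.1 hM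
  rw [FinProb.pr_not] at hsplit
  linarith

/-- Survival probability up to generation `k` of the Poisson branching process with mean `c`. -/
noncomputable def survival (c : ℝ) : ℕ → ℝ
  | 0 => 1
  | k + 1 => 1 - Real.exp (-(c * survival c k))

theorem survival_mem {c : ℝ} (hc : 0 ≤ c) (k : ℕ) : 0 ≤ survival c k ∧ survival c k ≤ 1 := by
  induction k with
  | zero => simp [survival]
  | succ k ih =>
    have : Real.exp (-(c * survival c k)) ≤ 1 :=
      Real.exp_le_one_iff.2 (by have := mul_nonneg hc ih.1; linarith)
    have := Real.exp_pos (-(c * survival c k))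
    constructor <;> simp only [survival] <;> linarith

theorem survival_antitone {c : ℝ} (hc : 0 ≤ c) : Antitone (survival c) := by
  refine antitone_nat_of_succ_le fun k => ?_
  induction k with
  | zero => exact (survival_mem hc 1).2
  | succ k ih =>
    have : Real.exp (-(c * survival c k)) ≤ Real.exp (-(c * survival c (k + 1))) :=
      Real.exp_le_exp.2 (by have := mul_le_mul_of_nonneg_left ih hc; linarith)
    show 1 - Real.exp (-(c * survival c (k + 1))) ≤ 1 - Real.exp (-(c * survival c k))
    linarith

theorem le_survival {c x : ℝ} (hc : 0 ≤ c) (hx : x ≤ 1) (h : x ≤ 1 - Real.exp (-(c * x))) (k : ℕ) :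
    x ≤ survival c k := by
  induction k with
  | zero => exact hx
  | succ k ih =>
    refine h.trans ?_
    have : Real.exp (-(c * survival c k)) ≤ Real.exp (-(c * x)) :=
      Real.exp_le_exp.2 (by have := mul_le_mul_of_nonneg_left ih hc; linarith)
    rw [survival]; linarith

/-- Zero is a fixed point too, and by strict convexity of `exp` three points cannot lie on one line.
-/
theorem fixedPoint_not_lt {c z w : ℝ} (hc : 0 < c) (hz : 0 < z) (hzw : z < w)
    (h1 : z = 1 - Real.exp (-(c * z))) (h2 : w = 1 - Real.exp (-(c * w))) : False := by
  have hw : 0 < w := hz.trans hzw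
  have h := strictConvexOn_exp.2 (Set.mem_univ (-(c * w))) (Set.mem_univ 0)
    (by have := mul_pos hc hw; intro h; linarith) (show 0 < z / w by positivity)
    (show 0 < 1 - z / w by rw [sub_pos, div_lt_one hw]; exact hzw) (by ring)
  simp only [smul_eq_mul, mul_zero, add_zero, Real.exp_zero, mul_one] at h
  rw [show z / w * -(c * w) = -(c * z) by field_simp, show Real.exp (-(c * z)) = 1 - z by linarith,
    show Real.exp (-(c * w)) = 1 - w by linarith] at h
  have : z / w * (1 - w) + (1 - z / w) = 1 - z := by field_simp; ring
  linarith

theorem exists_survival_limit {c : ℝ} (hc : 1 < c) :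
    ∃ y : ℝ, 0 < y ∧ y < 1 ∧ y = 1 - Real.exp (-(c * y)) ∧
      (∀ z : ℝ, 0 < z → z = 1 - Real.exp (-(c * z)) → z = y) ∧
      Tendsto (survival c) atTop (𝓝 y) ∧ ∀ k, y ≤ survival c k := by
  have h0 : 0 < c := by linarith
  have hx0 : 0 < (c - 1) / c := div_pos (by linarith) h0
  -- `(c - 1) / c` is a subsolution because `exp (c - 1) ≥ c`. It keeps the limit of the decreasing
  -- sequence positive.
  have hlow := le_survival h0.le (x := (c - 1) / c) (by rw [div_le_one h0]; linarith) (by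
    rw [mul_div_cancel₀ _ h0.ne', Real.exp_neg]
    have h1 := Real.add_one_le_exp (c - 1)
    have : (Real.exp (c - 1))⁻¹ ≤ c⁻¹ := inv_anti₀ h0 (by linarith)
    have e : (c - 1) / c = 1 - c⁻¹ := by field_simp
    linarith)
  have hbdd : BddBelow (Set.range (survival c)) := ⟨_, by rintro _ ⟨k, rfl⟩; exact hlow k⟩
  have hlim := tendsto_atTop_ciInf (survival_antitone h0.le) hbdd
  set y := ⨅ k, survival c k
  have hy0 : 0 < y := hx0.trans_le (le_ciInf hlow)
  have hfix : y = 1 - Real.exp (-(c * y)) := by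
    refine tendsto_nhds_unique (hlim.comp (tendsto_add_atTop_nat 1)) ?_
    exact ((Real.continuous_exp.tendsto _).comp ((hlim.const_mul c).neg)).const_sub 1
  refine ⟨y, hy0, ?_, hfix, fun z hz hzf => ?_, hlim, fun k => ciInf_le hbdd k⟩
  · have := Real.exp_pos (-(c * y))
    linarith
  · rcases lt_trichotomy z y with h | h | h
    · exact (fixedPoint_not_lt h0 hz h hzf hfix).elim
    · exact h
    · exact (fixedPoint_not_lt h0 hy0 h hfix hzf).elim

theorem tendsto_pathBound (c : ℝ) (k : ℕ) :
    Tendsto (fun d : ℕ => pathBound (c / d) d k) atTop (𝓝 (survival c k)) := by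
  induction k with
  | zero => simp [pathBound, survival]
  | succ k ih =>
    simp only [pathBound, survival]
    refine Tendsto.const_sub _ ?_
    simp_rw [sub_eq_add_neg (1 : ℝ)]
    refine Real.tendsto_one_add_pow_exp_of_tendsto ?_
    refine ((ih.const_mul c).neg).congr' ?_
    filter_upwards [eventually_gt_atTop 0] with d hd
    have : (d : ℝ) ≠ 0 := by positivity
    field_simp

/-- Here `n` is the nominal number of directions and `j` a bounded deficit. A generation discards at
most `M` further directions, which raises `j` but does not affect the limit. Uniformity in `d`, `p`
and `J` makes the bound usable in subcubes. -/
theorem le_pr_geoPath {c C : ℝ} (hc : 0 ≤ c) (k : ℕ) :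
    ∀ η > 0, ∀ j : ℕ, ∃ n₀ : ℕ, ∀ n ≥ n₀, ∀ d : ℕ, ∀ p : ℝ, ∀ h0 : 0 ≤ p, ∀ h1 : p ≤ 1,
      ∀ J : Finset (Fin d), ∀ v, n ≤ J.card + j → c ≤ n * p → p * J.card ≤ C →
      survival c k - η ≤ (FinProb.pi (Sym2 (Fin d → Bool)) (FinProb.ber p h0 h1)).pr
        fun ω => GeoPath ω k J v := by
  induction k with
  | zero =>
    intro η hη j
    refine ⟨0, fun n _ d p h0 h1 J v _ _ _ => ?_⟩
    simp only [GeoPath, FinProb.pr_true, survival]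
    linarith
  | succ k ih =>
    intro η hη j
    -- The error `η` is split in thirds: `M` handles the Markov term, `η'` the error of the previous
    -- generation multiplied by `c`, and `n₂` the deficit `j`.
    obtain ⟨M, hM⟩ := exists_nat_gt (C / (η / 3))
    set η' := η / 3 / (c + 1) with hη'
    have hη'0 : 0 < η' := by positivity
    obtain ⟨n₁, hn₁⟩ := ih η' hη'0 (j + M)
    obtain ⟨n₂, hn₂⟩ := exists_nat_gt (c * j / (η / 3))
    refine ⟨max n₁ (max n₂ (max j 1)), fun n hn d p h0 h1 J v hJ hcp hpC => ?_⟩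
    simp only [ge_iff_le, max_le_iff] at hn
    obtain ⟨hn1, hn2, hnj, hn0⟩ := hn
    have hn0' : (0 : ℝ) < n := by exact_mod_cast hn0
    have hs := survival_mem hc k
    set r := max 0 (survival c k - η') with hr
    have hr1 : r ≤ 1 := max_le zero_le_one (by linarith)
    have hr0 : 0 ≤ r := le_max_left _ _
    have hstep := le_pr_geoPath_succ h0 h1 hr1 k M J v fun w J' hJ' => by
      by_cases hpC' : p * J'.card ≤ C
      · exact max_le (FinProb.pr_nonneg _ _) (hn₁ n hn1 d p h0 h1 J' w (by omega) hcp hpC')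
      -- If `J'` is too large for the bound `C`, it is shrunk to at most the size of `J`; this only
      -- lowers the probability.
      · obtain ⟨J'', hsub, hcard⟩ := exists_subset_card_eq (s := J') (n := min J'.card J.card)
          (min_le_left _ _)
        refine (max_le (FinProb.pr_nonneg _ _) (hn₁ n hn1 d p h0 h1 J'' w ?_ hcp ?_)).trans
          (FinProb.pr_mono _ fun ω hω => hω.mono hsub)
        · omega
        · refine le_trans (mul_le_mul_of_nonneg_left ?_ h0) hpC
          rw [hcard]
          exact_mod_cast min_le_right _ _
    refine le_trans ?_ hstep
    have hM1 : p * J.card / (M + 1) ≤ η / 3 := by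
      rw [div_le_iff₀ (by positivity)]
      rw [div_lt_iff₀ (by positivity)] at hM
      nlinarith
    have hpow : (1 - p * r) ^ J.card ≤ Real.exp (-(p * r * J.card)) := by
      have h2 : 0 ≤ 1 - p * r := by nlinarith
      calc (1 - p * r) ^ J.card ≤ (Real.exp (-(p * r))) ^ J.card :=
            pow_le_pow_left₀ h2 (by have := Real.add_one_le_exp (-(p * r)); linarith) _
        _ = _ := by rw [← Real.exp_nat_mul]; congr 1; ring
    have hx : c * survival c k - 2 * (η / 3) ≤ p * r * J.card := by
      have e1 : (n : ℝ) - j ≤ J.card := by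
        have : (n : ℝ) ≤ J.card + j := by exact_mod_cast hJ
        linarith
      have e2 : c * j ≤ η / 3 * n := by
        rw [div_lt_iff₀ (by positivity)] at hn₂
        have : (n₂ : ℝ) ≤ n := by exact_mod_cast hn2
        nlinarith
      have e3 : c - η / 3 ≤ p * (n - j) := by
        have hnj' : (j : ℝ) ≤ n := by exact_mod_cast hnj
        have : c * (n - j) ≤ p * (n - j) * n := by
          have := mul_le_mul_of_nonneg_right hcp (sub_nonneg.2 hnj')
          linarith
        have : (c - η / 3) * n ≤ p * (n - j) * n := by linarith
        exact le_of_mul_le_mul_right this hn0'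
      have e4 : c - η / 3 ≤ p * J.card := e3.trans (mul_le_mul_of_nonneg_left e1 h0)
      have e5 : survival c k - η' ≤ r := le_max_right _ _
      have e6 : c * η' ≤ η / 3 := by
        rw [hη', mul_div_assoc', div_le_iff₀ (by positivity)]
        nlinarith
      have e7 : (c - η / 3) * r ≤ p * J.card * r := mul_le_mul_of_nonneg_right e4 hr0
      nlinarith
    have hexp : Real.exp (-(p * r * J.card)) ≤ Real.exp (-(c * survival c k)) + 2 * (η / 3) := by
      set a := c * survival c k with ha
      have ha0 : 0 ≤ a := mul_nonneg hc hs.1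
      set b := p * r * J.card with hb
      have hb0 : 0 ≤ b := by positivity
      rcases le_total a b with hab | hab
      · have : Real.exp (-b) ≤ Real.exp (-a) := Real.exp_le_exp.2 (by linarith)
        linarith
      · have h2 : Real.exp (-a) = Real.exp (-b) * Real.exp (b - a) := by
          rw [← Real.exp_add]; congr 1; ring
        have h3 := Real.add_one_le_exp (b - a)
        have h4 : Real.exp (-b) ≤ 1 := Real.exp_le_one_iff.2 (by linarith)
        have h5 := Real.exp_pos (-b)
        rw [h2]
        nlinarith
    simp only [survival]
    linarith

end Branching

/-! ### Trees of intermediate size. -/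

section MiddleTrees
open Finset
open scoped Classical

section general
variable {V : Type*} [Fintype V] [DecidableEq V]

/-- There is a tree at `v` with more than `k` and at most `N` vertices whose edges are open in
`ω₂` and all of whose boundary edges are closed in `ω₁`. -/
def HasMiddleTree (G : SimpleGraph V) (ω₁ ω₂ : Sym2 V → Bool) (k N : ℕ) (v : V) : Prop :=
  ∃ S F, TreeAt v S F ∧ k < S.card ∧ S.card ≤ N ∧
    (∀ e ∈ F, e ∈ (openSubgraph G ω₂).edgeSet) ∧ ∀ e ∈ boundary G S, ¬ ω₁ e = true

theorem closed_of_mem_boundary {G : SimpleGraph V} {ω : Sym2 V → Bool} {S : Finset V}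
    (hS : ∀ x ∈ S, comp (openSubgraph G ω) x ⊆ S) : ∀ e ∈ boundary G S, ¬ ω e = true := by
  intro e he hω
  simp only [boundary, mem_filter, mem_univ, true_and] at he
  obtain ⟨hG, ⟨x, hx, hxe⟩, y, hy, hye⟩ := he
  have hxy : x ≠ y := by rintro rfl; exact hy hx
  obtain rfl := (Sym2.mem_and_mem_iff hxy).1 ⟨hxe, hye⟩
  have hadj : (openSubgraph G ω).Adj x y := ⟨hG, hω⟩
  exact hy (hS x hx (mem_comp.2 hadj.reachable))

theorem HasMiddleTree.of_card_comp {G : SimpleGraph V} {ω₁ ω ω₂ : Sym2 V → Bool} (h₁ : ω₁ ≤ ω)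
    (h₂ : ω ≤ ω₂) {k N : ℕ} {v : V} (hk : k < (comp (openSubgraph G ω) v).card)
    (hN : (comp (openSubgraph G ω) v).card ≤ N) : HasMiddleTree G ω₁ ω₂ k N v := by
  obtain ⟨F, hT, hF⟩ := TreeAt.exists_comp (openSubgraph G ω) v
  refine ⟨_, F, hT, hk, hN, fun e he => ?_, fun e he h => ?_⟩
  · exact SimpleGraph.edgeSet_mono (openSubgraph_mono le_rfl h₂) (hF e he)
  · refine closed_of_mem_boundary (fun x hx => ?_) e he
      (top_le_iff.1 (h ▸ h₁ e : true ≤ ω e))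
    rw [comp_eq_of_mem hx]

/-- A large component of `ω₂` contains a large component of `ω₁`, unless a tree of intermediate
size exists. -/
theorem exists_large_comp_or_hasMiddleTree {G : SimpleGraph V} {ω₁ ω₂ : Sym2 V → Bool} (h : ω₁ ≤ ω₂)
    {k N : ℕ} (hkN : 2 * k ≤ N) {v : V} (hk : k < (comp (openSubgraph G ω₂) v).card) :
    (∃ w ∈ comp (openSubgraph G ω₂) v, k < (comp (openSubgraph G ω₁) w).card) ∨
      HasMiddleTree G ω₁ ω₂ k N v := by
  by_contra hcon
  push Not at hcon
  obtain ⟨hsmall, hno⟩ := hcon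
  have hle : openSubgraph G ω₁ ≤ openSubgraph G ω₂ := openSubgraph_mono le_rfl h
  have hvv : v ∈ comp (openSubgraph G ω₂) v := mem_comp.2 (SimpleGraph.Reachable.refl _)
  obtain ⟨F₀, hT₀, hF₀⟩ := TreeAt.exists_comp (openSubgraph G ω₁) v
  -- Take a largest union of `ω₁`-components, spanned by an `ω₂`-open tree at `v`, with at most `k`
  -- vertices.
  obtain ⟨S, hS, hmax⟩ := Finset.exists_max_image
    (univ.filter fun S : Finset V => (∃ F, TreeAt v S F ∧
      ∀ e ∈ F, e ∈ (openSubgraph G ω₂).edgeSet) ∧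
      (∀ x ∈ S, comp (openSubgraph G ω₁) x ⊆ S) ∧ S.card ≤ k) card
    ⟨comp (openSubgraph G ω₁) v, by
      simp only [mem_filter, mem_univ, true_and]
      exact ⟨⟨F₀, hT₀, fun e he => SimpleGraph.edgeSet_mono hle (hF₀ e he)⟩,
        fun x hx => (comp_eq_of_mem hx).subset, hsmall v hvv⟩⟩
  simp only [mem_filter, mem_univ, true_and] at hS hmax
  obtain ⟨⟨F, hT, hF⟩, hcl, hSk⟩ := hS
  have hex : ∃ x ∈ S, ∃ w, w ∉ S ∧ (openSubgraph G ω₂).Adj x w := by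
    by_contra hcon
    push Not at hcon
    have hsub : comp (openSubgraph G ω₂) v ⊆ S := by
      intro w hw
      obtain ⟨p⟩ := mem_comp.1 hw
      have key : ∀ {a b : V}, (openSubgraph G ω₂).Walk a b → a ∈ S → b ∈ S := by
        intro a b p
        induction p with
        | nil => exact id
        | @cons a b c hab _ ih =>
          intro ha
          refine ih ?_
          by_contra hb
          exact hcon a ha b hb hab
      exact key p hT.root_mem
    have := card_le_card hsub
    omega
  obtain ⟨x, hx, w, hw, hxw⟩ := hex
  obtain ⟨F', hT', hF'⟩ := TreeAt.exists_comp (openSubgraph G ω₁) w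
  have hww : w ∈ comp (openSubgraph G ω₁) w := mem_comp.2 (SimpleGraph.Reachable.refl _)
  have hdis : Disjoint S (comp (openSubgraph G ω₁) w) := by
    rw [Finset.disjoint_left]
    intro z hz hzw
    refine hw (hcl z hz ?_)
    rw [comp_eq_of_mem hzw]; exact hww
  have hwv : w ∈ comp (openSubgraph G ω₂) v :=
    mem_comp.2 ((hT.reachable hF x hx).trans hxw.reachable)
  have hcw := hsmall w hwv
  have hpos : 0 < (comp (openSubgraph G ω₁) w).card := card_pos.2 ⟨w, hww⟩
  have hcard := card_union_of_disjoint hdis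
  have hTj := hT.join hT' hdis hx
  have hFj : ∀ e ∈ insert s(x, w) (F ∪ F'), e ∈ (openSubgraph G ω₂).edgeSet := by
    intro e he
    rcases mem_insert.1 he with rfl | he
    · exact hxw
    · rcases mem_union.1 he with he | he
      · exact hF e he
      · exact SimpleGraph.edgeSet_mono hle (hF' e he)
  have hclj : ∀ z ∈ S ∪ comp (openSubgraph G ω₁) w,
      comp (openSubgraph G ω₁) z ⊆ S ∪ comp (openSubgraph G ω₁) w := by
    intro z hz
    rcases mem_union.1 hz with hz | hz
    · exact (hcl z hz).trans subset_union_left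
    · rw [comp_eq_of_mem hz]; exact subset_union_right
  by_cases hk' : (S ∪ comp (openSubgraph G ω₁) w).card ≤ k
  · have := hmax _ ⟨⟨_, hTj, hFj⟩, hclj, hk'⟩
    omega
  -- The absorbed component has at most `k` vertices, so the union jumps to a size in `(k, 2k]` and
  -- `2k ≤ N`.
  · exact hno ⟨_, _, hTj, by omega, by omega, hFj, closed_of_mem_boundary hclj⟩

end general

variable {d : ℕ}

/-- With auxiliary density `1 / d` the tree count contributes about `e` per vertex, the open edges
`c`, and the closed boundary `exp (-(1 - κ) (1 - 2 κ) c)`. The factor `1 - κ` comes from the smaller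
first-layer density, `1 - 2 κ` from the `κ d` missing directions and the `κ d` lost to isoperimetry.
-/
theorem pr_tree_size_le {c κ β : ℝ} (hc : 1 < c) (hκ0 : 0 < κ) (hκ1 : κ < 1 / 2)
    (hβ : β < (1 - κ) * (1 - 2 * κ) * c - 1 - Real.log c) {X : Type*} [Fintype X] :
    ∀ᶠ d : ℕ in atTop, ∀ (P : FinProb X) (O₁ O₂ : X → Prop), P.pr O₂ ≤ c / d →
      (1 - κ) * c / d ≤ P.pr O₁ → ∀ J : Finset (Fin d), (1 - κ) * d ≤ J.card →
      ∀ v, ∀ s ≤ 2 ^ ⌊κ * d⌋₊,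
      (FinProb.pi (Sym2 (Fin d → Bool)) P).pr (fun ω => ∃ T ∈ trees (dirCube J) v s,
        (∀ e ∈ T.2, O₂ (ω e)) ∧ ∀ e ∈ boundary (dirCube J) T.1, ¬ O₁ (ω e)) ≤
        Real.exp (-β) ^ s := by
  set A := (1 - κ) * (1 - 2 * κ) * c with hA
  -- The slack `g` absorbs the convergence of `(1 - 1/d) ^ d` to `exp (-1)`.
  set g := A - 1 - Real.log c - β with hg
  have hg0 : 0 < g := by linarith
  have hlim := (Real.tendsto_one_add_div_pow_exp (-1)).eventually
    (lt_mem_nhds (show Real.exp (-(1 + g)) < Real.exp (-1) from Real.exp_lt_exp.2 (by linarith)))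
  filter_upwards [hlim, eventually_ge_atTop 2] with d hd hd2 P O₁ O₂ h2 h1 J hJ v s hs
  have hd0 : (0 : ℝ) < d := by positivity
  have hd1 : (1 : ℝ) < d := by exact_mod_cast hd2
  set a := ⌊κ * d⌋₊ with ha
  have ha' : (a : ℝ) ≤ κ * d := Nat.floor_le (by positivity)
  have hq0 : (0 : ℝ) < 1 / d := by positivity
  have hq1 : (1 : ℝ) / d < 1 := by rw [div_lt_one hd0]; exact hd1
  refine (pr_exists_tree_le P O₁ O₂ (D := d) (fun x => degree_dirCube_le J x) v s (s * (J.card - a))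
    (fun S hS => by rw [← hS]; exact card_mul_le_card_boundary J (by rw [hS]; exact hs))
    hq0 hq1).trans ?_
  have e1 : (P.pr O₂ / (1 / d)) ^ (s - 1) ≤ c ^ s := by
    have : P.pr O₂ / (1 / d) ≤ c := by
      rw [div_div_eq_mul_div, div_one]; rwa [le_div_iff₀ hd0] at h2
    calc (P.pr O₂ / (1 / d)) ^ (s - 1) ≤ c ^ (s - 1) :=
          pow_le_pow_left₀ (div_nonneg (P.pr_nonneg _) hq0.le) this _
      _ ≤ c ^ s := pow_le_pow_right₀ hc.le (by omega)
  have e2 : (1 - P.pr O₁) ^ (s * (J.card - a)) ≤ Real.exp (-A) ^ s := by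
    have hp1 := P.pr_le_one O₁
    rw [mul_comm, pow_mul]
    refine pow_le_pow_left₀ (pow_nonneg (by linarith) _) ?_ _
    have hsub : (1 - 2 * κ) * d ≤ ((J.card - a : ℕ) : ℝ) := by
      have : (J.card : ℝ) ≤ ((J.card - a : ℕ) : ℝ) + a := by exact_mod_cast le_tsub_add
      linarith
    calc (1 - P.pr O₁) ^ (J.card - a) ≤ (Real.exp (-P.pr O₁)) ^ (J.card - a) :=
          pow_le_pow_left₀ (by linarith)
            (by have := Real.add_one_le_exp (-P.pr O₁); linarith) _
      _ = Real.exp (-(P.pr O₁ * ((J.card - a : ℕ) : ℝ))) := by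
          rw [← Real.exp_nat_mul]; congr 1; ring
      _ ≤ Real.exp (-A) := by
          refine Real.exp_le_exp.2 (neg_le_neg ?_)
          calc A = (1 - κ) * c / d * ((1 - 2 * κ) * d) := by rw [hA]; field_simp
            _ ≤ _ := mul_le_mul h1 hsub (by nlinarith) (P.pr_nonneg _)
  have e3 : Real.exp (-(1 + g)) ^ s ≤ (1 - 1 / (d : ℝ)) ^ (s * d) := by
    rw [mul_comm, pow_mul]
    refine pow_le_pow_left₀ (Real.exp_pos _).le ?_ _
    rw [sub_eq_add_neg, ← neg_div]
    exact hd.le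
  rw [div_le_iff₀ (pow_pos (by linarith) _)]
  refine (mul_le_mul e1 e2 (pow_nonneg (by have := P.pr_le_one O₁; linarith) _)
    (by positivity)).trans ?_
  refine le_trans ?_ (mul_le_mul_of_nonneg_left e3 (by positivity))
  rw [← mul_pow, ← mul_pow]
  refine le_of_eq ?_
  congr 1
  nth_rewrite 1 [← Real.exp_log (show 0 < c by linarith)]
  rw [← Real.exp_add, ← Real.exp_add]
  congr 1
  rw [hg]; ring

/-- A geometric sum over the tree sizes. Both open sets are read from one label per edge, so the
bound serves a single layer (`X = Bool`) as well as two coupled ones (`X = Bool × Bool`). -/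
theorem pr_hasMiddleTree_le {c κ β : ℝ} (hc : 1 < c) (hκ0 : 0 < κ) (hκ1 : κ < 1 / 2)
    (hβ0 : 0 < β) (hβ : β < (1 - κ) * (1 - 2 * κ) * c - 1 - Real.log c) {X : Type*} [Fintype X] :
    ∀ᶠ d : ℕ in atTop, ∀ (P : FinProb X) (f₁ f₂ : X → Bool), P.pr (fun x => f₂ x = true) ≤ c / d →
      (1 - κ) * c / d ≤ P.pr (fun x => f₁ x = true) →
      ∀ J : Finset (Fin d), (1 - κ) * d ≤ J.card → ∀ v k,
      (FinProb.pi (Sym2 (Fin d → Bool)) P).pr (fun ω => HasMiddleTree (dirCube J)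
        (fun e => f₁ (ω e)) (fun e => f₂ (ω e)) k (2 ^ ⌊κ * d⌋₊) v) ≤
        Real.exp (-β) ^ (k + 1) / (1 - Real.exp (-β)) := by
  filter_upwards [pr_tree_size_le hc hκ0 hκ1 hβ (X := X)] with d hd P f₁ f₂ h2 h1 J hJ v k
  set N := 2 ^ ⌊κ * d⌋₊
  have hb1 : Real.exp (-β) < 1 := by
    rw [← Real.exp_zero]; exact Real.exp_lt_exp.2 (by linarith)
  refine (FinProb.pr_mono _ fun ω hω => ?_).trans
    ((FinProb.pr_exists_le _ (Finset.Ico (k + 1) (N + 1)) fun s ω => ∃ T ∈ trees (dirCube J) v s,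
        (∀ e ∈ T.2, f₂ (ω e) = true) ∧ ∀ e ∈ boundary (dirCube J) T.1, ¬ f₁ (ω e) = true).trans ?_)
  · obtain ⟨S, F, hT, hk, hN, hF, hb⟩ := hω
    refine ⟨S.card, by rw [mem_Ico]; omega, (S, F), ?_, fun e he => ?_, hb⟩
    · simp only [trees, mem_filter, mem_univ, true_and]
      exact ⟨hT, fun e he => (mem_edgeSet_openSubgraph.1 (hF e he)).1⟩
    · exact (mem_edgeSet_openSubgraph.1 (hF e he)).2
  · refine (Finset.sum_le_sum fun s hs => hd P _ _ h2 h1 J hJ v s ?_).trans ?_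
    · rw [mem_Ico] at hs; omega
    · exact geom_sum_Ico_le_of_lt_one (Real.exp_pos _).le hb1

end MiddleTrees

/-! ### Large components near every vertex. -/

section Density
open Finset
open scoped Classical
variable {d : ℕ}

theorem comp_subset_of_agree {J : Finset (Fin d)} {ω ω' : Sym2 (Fin d → Bool) → Bool}
    {v : Fin d → Bool} (h : ∀ e ∈ edgesIn (cell J v), ω e = ω' e) :
    comp (openSubgraph (dirCube J) ω) v ⊆ comp (openSubgraph (dirCube J) ω') v := by
  intro x hx
  obtain ⟨p⟩ := mem_comp.1 hx
  have key : ∀ {a b : Fin d → Bool}, (openSubgraph (dirCube J) ω).Walk a b → a ∈ cell J v →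
      (openSubgraph (dirCube J) ω').Reachable a b := by
    intro a b p
    induction p with
    | nil => exact fun _ => SimpleGraph.Reachable.refl _
    | @cons a b c hab _ ih =>
      intro ha
      obtain ⟨⟨i, hi, rfl⟩, ho⟩ := hab
      have hb := toggle_mem_cell hi ha
      refine SimpleGraph.Reachable.trans (SimpleGraph.Adj.reachable ⟨⟨i, hi, rfl⟩, ?_⟩) (ih hb)
      rw [← h _ fun y hy => ?_, ho]
      rcases Sym2.mem_iff.1 hy with rfl | rfl <;> assumption
  exact mem_comp.2 (key p (self_mem_cell J v))

theorem dependsOn_card_comp (J : Finset (Fin d)) (v : Fin d → Bool) (K : ℕ) :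
    DependsOn (fun ω => K < (comp (openSubgraph (dirCube J) ω) v).card) (edgesIn (cell J v)) := by
  intro ω ω' h
  have : comp (openSubgraph (dirCube J) ω) v = comp (openSubgraph (dirCube J) ω') v :=
    (comp_subset_of_agree h).antisymm (comp_subset_of_agree fun e he => (h e he).symm)
  simp only [this]

/-- Flipping one coordinate in `D₁` and one in `D₂` gives `|D₁| |D₂|` vertices. Their subcubes in
the remaining directions are disjoint, since the frozen coordinates reveal the flipped pair, so
these trials are independent. -/
theorem pr_no_large_comp_near_le (P : FinProb Bool) {D₁ D₂ : Finset (Fin d)} (hD : Disjoint D₁ D₂)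
    (v : Fin d → Bool) (K : ℕ) {α : ℝ}
    (h : ∀ w, α ≤ (FinProb.pi (Sym2 (Fin d → Bool)) P).pr fun ω =>
      K < (comp (openSubgraph (dirCube (univ \ (D₁ ∪ D₂))) ω) w).card) :
    (FinProb.pi (Sym2 (Fin d → Bool)) P).pr (fun ω => ¬ ∃ i j, K < (comp (openSubgraph
      (dirCube univ) ω) (toggle i (toggle j v))).card) ≤ (1 - α) ^ (D₁.card * D₂.card) := by
  set J := univ \ (D₁ ∪ D₂) with hJ
  refine (FinProb.pr_mono _ (B := fun ω => ∀ z ∈ D₁ ×ˢ D₂, ¬ K < (comp (openSubgraph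
    (dirCube J) ω) (toggle z.1 (toggle z.2 v))).card) fun ω hω z _ hz => hω ⟨z.1, z.2,
      hz.trans_le (card_le_card fun x hx => ?_)⟩).trans ?_
  · rw [FinProb.pr_pi_forall_dependsOn P (D₁ ×ˢ D₂)
      (A := fun z ω => ¬ K < (comp (openSubgraph (dirCube J) ω) (toggle z.1 (toggle z.2 v))).card)
      (I := fun z => edgesIn (cell J (toggle z.1 (toggle z.2 v))))]
    · rw [← card_product, ← prod_const]
      refine prod_le_prod (fun _ _ => FinProb.pr_nonneg _ _) fun z _ => ?_
      rw [FinProb.pr_not]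
      linarith [h (toggle z.1 (toggle z.2 v))]
    · intro z _ ω ω' hω
      exact congrArg Not (dependsOn_card_comp J _ K hω)
    · rintro ⟨i, j⟩ hz ⟨i', j'⟩ hz' hne
      rw [mem_product] at hz hz'
      refine edgesIn_disjoint ?_
      rw [Set.disjoint_left]
      intro x hx hx'
      have hvals : ∀ l ∈ D₁ ∪ D₂, toggle i (toggle j v) l = toggle i' (toggle j' v) l :=
        fun l hl => by
          rw [← hx l (by simp [hJ, hl]), ← hx' l (by simp [hJ, hl])]
      have hcross : ∀ {a b : Fin d}, a ∈ D₁ → b ∈ D₂ → a ≠ b := fun ha hb => by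
        rintro rfl; exact Finset.disjoint_left.1 hD ha hb
      have hi : i = i' := by
        by_contra hii
        have := hvals i (mem_union_left _ hz.1)
        rw [toggle_apply_self, toggle_apply_of_ne (hcross hz.1 hz.2), toggle_apply_of_ne hii,
          toggle_apply_of_ne (hcross hz.1 hz'.2)] at this
        exact Bool.not_ne_self _ this
      have hj : j = j' := by
        by_contra hjj
        have := hvals j (mem_union_right _ hz.2)
        rw [toggle_apply_of_ne (hcross hz.1 hz.2).symm, toggle_apply_self,
          toggle_apply_of_ne (hcross hz'.1 hz.2).symm, toggle_apply_of_ne hjj] at this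
        exact Bool.not_ne_self _ this
      exact hne (by rw [hi, hj])
  · rw [mem_comp] at hx ⊢
    exact hx.mono (openSubgraph_mono (dirCube_mono (subset_univ _)) le_rfl)

end Density

/-! ### Sprinkling. -/

section Merging
open Finset
open scoped Classical
variable {d : ℕ}

/-- The balls of radius `r` around a maximal separated subset cover `X`. -/
theorem exists_separated_subset (X : Finset (Fin d → Bool)) (r : ℕ) :
    ∃ Y ⊆ X, (∀ x ∈ Y, ∀ y ∈ Y, x ≠ y → r < hammingDist x y) ∧ X.card ≤ Y.card * (d + 1) ^ r := by
  obtain ⟨Y, hY, hmax⟩ := Finset.exists_max_image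
    (X.powerset.filter fun Y => ∀ x ∈ Y, ∀ y ∈ Y, x ≠ y → r < hammingDist x y) card
    ⟨∅, by simp⟩
  simp only [mem_filter, mem_powerset] at hY hmax
  refine ⟨Y, hY.1, hY.2, ?_⟩
  have hcov : X ⊆ Y.biUnion fun y => univ.filter fun w => hammingDist y w ≤ r := by
    intro x hx
    by_contra hcon
    simp only [mem_biUnion, mem_filter, mem_univ, true_and, not_exists, not_and, not_le] at hcon
    have hxY : x ∉ Y := fun h => by simpa using hcon x h
    have := hmax (insert x Y) ⟨insert_subset hx hY.1, fun a ha b hb hab => by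
      rcases mem_insert.1 ha with rfl | ha' <;> rcases mem_insert.1 hb with rfl | hb'
      · exact absurd rfl hab
      · rw [hammingDist_comm]; exact hcon b hb'
      · exact hcon a ha'
      · exact hY.2 a ha' b hb' hab⟩
    rw [card_insert_of_notMem hxY] at this
    omega
  exact (card_le_card hcov).trans (card_biUnion_le_card_mul _ _ _ fun y _ => card_hammingBall_le y r)

theorem hammingDist_toggle (i : Fin d) (x : Fin d → Bool) : hammingDist x (toggle i x) = 1 :=
  hammingDist_of_adj (dirCube_adj_toggle (mem_univ i) x)

/-- `Q` is a set of at most `k` edges of the cube, within distance `r` of `x`, that connects `x` to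
`y`. -/
structure Connects (Q : Finset (Sym2 (Fin d → Bool))) (k r : ℕ) (z x y : Fin d → Bool) : Prop where
  card_le : Q.card ≤ k
  sub_ball : ∀ e ∈ Q, e ∈ edgesIn {w | hammingDist z w ≤ r}
  sub_edges : ∀ e ∈ Q, e ∈ (dirCube (univ : Finset (Fin d))).edgeSet
  reachable : ∀ H : SimpleGraph (Fin d → Bool), (∀ e ∈ Q, e ∈ H.edgeSet) → H.Reachable x y

theorem Connects.refl (z x : Fin d → Bool) : Connects ∅ 0 0 z x x :=
  ⟨by simp, by simp, by simp, fun H _ => SimpleGraph.Reachable.refl _⟩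

theorem Connects.edge (i : Fin d) (x : Fin d → Bool) :
    Connects {s(x, toggle i x)} 1 1 x x (toggle i x) := by
  refine ⟨by simp, ?_, ?_, fun H h => SimpleGraph.Adj.reachable (h _ (mem_singleton_self _))⟩
  · intro e he y hy
    rw [mem_singleton] at he
    subst he
    rcases Sym2.mem_iff.1 hy with rfl | rfl
    · simp
    · exact (hammingDist_toggle i x).le
  · intro e he
    rw [mem_singleton] at he
    subst he
    exact dirCube_adj_toggle (mem_univ i) x

theorem Connects.trans {Q Q' : Finset (Sym2 (Fin d → Bool))} {k k' r r' : ℕ}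
    {z x y w : Fin d → Bool} (h : Connects Q k r z x y) (h' : Connects Q' k' r' z y w) :
    Connects (Q ∪ Q') (k + k') (max r r') z x w := by
  refine ⟨(card_union_le _ _).trans (add_le_add h.card_le h'.card_le), ?_, ?_, ?_⟩
  · intro e he a ha
    rcases mem_union.1 he with he | he
    · exact le_trans (h.sub_ball e he a ha) (le_max_left r r')
    · exact le_trans (h'.sub_ball e he a ha) (le_max_right r r')
  · intro e he
    rcases mem_union.1 he with he | he
    · exact h.sub_edges e he
    · exact h'.sub_edges e he
  · exact fun H hH => (h.reachable H fun e he => hH e (mem_union_left _ he)).trans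
      (h'.reachable H fun e he => hH e (mem_union_right _ he))

theorem Connects.symm {Q : Finset (Sym2 (Fin d → Bool))} {k r : ℕ} {z x y : Fin d → Bool}
    (h : Connects Q k r z x y) : Connects Q k r z y x :=
  ⟨h.card_le, h.sub_ball, h.sub_edges, fun H hH => (h.reachable H hH).symm⟩

theorem Connects.weaken {Q : Finset (Sym2 (Fin d → Bool))} {k k' r r' : ℕ} {z z' x y : Fin d → Bool}
    (h : Connects Q k r z x y) (hk : k ≤ k') (hr : hammingDist z' z + r ≤ r') :
    Connects Q k' r' z' x y :=
  ⟨h.card_le.trans hk, fun e he a ha => by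
    have h1 : hammingDist z a ≤ r := h.sub_ball e he a ha
    have h2 := hammingDist_triangle z' z a
    show hammingDist z' a ≤ r'
    omega, h.sub_edges, h.reachable⟩

theorem exists_connects_near {x w : Fin d → Bool}
    (h : w = x ∨ ∃ i j, w = toggle i (toggle j x)) : ∃ Q, Connects Q 2 2 x x w := by
  rcases h with rfl | ⟨i, j, rfl⟩
  · exact ⟨∅, (Connects.refl w w).weaken (by omega) (by simp)⟩
  · refine ⟨_, ((Connects.edge j x).trans ((Connects.edge i (toggle j x)).weaken (z' := x) le_rfl
      (r' := 2) (by rw [hammingDist_toggle]))).weaken (by omega) (by simp)⟩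

/-- Two edges, the given edge, and two more; the last detour starts one step from `x`, whence radius
`3`. -/
theorem exists_connects_edge {φ : (Fin d → Bool) → Fin d → Bool}
    (hφ : ∀ x, φ x = x ∨ ∃ i j, φ x = toggle i (toggle j x)) (i : Fin d) (x : Fin d → Bool) :
    ∃ Q, Connects Q 5 3 x (φ x) (φ (toggle i x)) := by
  obtain ⟨Q, hQ⟩ := exists_connects_near (hφ x)
  obtain ⟨Q', hQ'⟩ := exists_connects_near (hφ (toggle i x))
  have h1 := hQ'.weaken (z' := x) le_rfl (r' := 3) (by rw [hammingDist_toggle])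
  exact ⟨_, ((hQ.symm.trans (Connects.edge i x)).trans h1).weaken (by omega) (by simp)⟩

theorem boundary_compl (G : SimpleGraph (Fin d → Bool)) (S : Finset (Fin d → Bool)) :
    boundary G Sᶜ = boundary G S := by
  ext e
  simp only [boundary, mem_filter, mem_univ, true_and, mem_compl, not_not]
  tauto

/-- One of `S` and `Sᶜ` has at most `2 ^ (d - 1)` vertices and so expands by the factor `d - (d - 1)
= 1`. -/
theorem min_card_le_card_boundary (hd : 0 < d) (S : Finset (Fin d → Bool)) {m : ℕ}
    (h1 : m ≤ S.card) (h2 : m ≤ Sᶜ.card) : m ≤ (boundary (dirCube univ) S).card := by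
  have htot : S.card + Sᶜ.card = 2 ^ d := by
    rw [card_add_card_compl]; simp
  have hpow : 2 ^ d = 2 ^ (d - 1) + 2 ^ (d - 1) := by
    obtain ⟨n, rfl⟩ : ∃ n, d = n + 1 := ⟨d - 1, by omega⟩
    rw [Nat.add_sub_cancel, pow_succ]; ring
  have hone : d - (d - 1) = 1 := by omega
  rcases le_total S.card (2 ^ (d - 1)) with h | h
  · have := card_mul_le_card_boundary univ h
    rw [card_univ, Fintype.card_fin, hone, mul_one] at this
    omega
  · have := card_mul_le_card_boundary univ (S := Sᶜ) (a := d - 1) (by omega)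
    rw [card_univ, Fintype.card_fin, hone, mul_one, boundary_compl] at this
    omega

theorem card_boundary_le (S : Finset (Fin d → Bool)) :
    (boundary (dirCube univ) S).card ≤ (S.filter fun x => ∃ i, toggle i x ∉ S).card * d := by
  have hsub : boundary (dirCube univ) S ⊆ (S.filter fun x => ∃ i, toggle i x ∉ S).biUnion
      fun x => univ.image fun i => s(x, toggle i x) := by
    intro e he
    simp only [boundary, mem_filter, mem_univ, true_and] at he
    obtain ⟨hG, ⟨x, hx, hxe⟩, y, hy, hye⟩ := he
    have hxy : x ≠ y := by rintro rfl; exact hy hx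
    obtain rfl := (Sym2.mem_and_mem_iff hxy).1 ⟨hxe, hye⟩
    obtain ⟨i, -, hyi⟩ := (hG : (dirCube univ).Adj x y)
    change y = toggle i x at hyi
    subst hyi
    simp only [mem_biUnion, mem_filter, mem_image, mem_univ, true_and]
    exact ⟨x, ⟨hx, i, hy⟩, i, rfl⟩
  refine (card_le_card hsub).trans (card_biUnion_le_card_mul _ _ _ fun x _ => ?_)
  exact card_image_le.trans (by simp)

/-- The map `φ` divides the whole cube into the points sent to `A` and those sent to `B`. Every edge
across this division yields a connection from `A` to `B` with at most five edges, and isoperimetry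
supplies many such edges. -/
theorem pr_not_connected_le (hd : 0 < d) {p : ℝ} (h0 : 0 ≤ p) (h1 : p ≤ 1)
    {φ : (Fin d → Bool) → Fin d → Bool}
    (hφ : ∀ x, φ x = x ∨ ∃ i j, φ x = toggle i (toggle j x)) {A B : Finset (Fin d → Bool)}
    (hA : ∀ x ∈ A, φ x = x) (hB : ∀ x ∈ B, φ x = x) (hAB : Disjoint A B)
    (hcov : ∀ x, φ x ∈ A ∪ B) {m : ℕ} (hmA : m ≤ A.card) (hmB : m ≤ B.card) :
    (FinProb.pi (Sym2 (Fin d → Bool)) (FinProb.ber p h0 h1)).pr (fun ω => ∀ a ∈ A, ∀ b ∈ B,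
      ¬ (openSubgraph (dirCube univ) ω).Reachable a b) ≤
      Real.exp (-(p ^ 5 * m / (d * (d + 1) ^ 6))) := by
  set S : Finset (Fin d → Bool) := univ.filter fun x => φ x ∈ A with hS
  have hAS : A ⊆ S := fun x hx => by simp [hS, hA x hx, hx]
  have hBS : B ⊆ Sᶜ := fun x hx => by
    simp only [hS, mem_compl, mem_filter, mem_univ, true_and, hB x hx]
    exact Finset.disjoint_right.1 hAB hx
  set X := S.filter fun x => ∃ i, toggle i x ∉ S with hX
  have hXm : m ≤ X.card * d := (min_card_le_card_boundary hd S (hmA.trans (card_le_card hAS))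
    (hmB.trans (card_le_card hBS))).trans (card_boundary_le S)
  -- Connections stay within distance `3` of their base point, so separation beyond `6` makes them
  -- edge-disjoint and hence independent.
  obtain ⟨Y, hYX, hsep, hYc⟩ := exists_separated_subset X 6
  have hQ : ∀ y ∈ Y, ∃ Q b, b ∈ B ∧ Connects Q 5 3 y (φ y) b := by
    intro y hy
    obtain ⟨hyS, i, hi⟩ := mem_filter.1 (hYX hy)
    obtain ⟨Q, hQ⟩ := exists_connects_edge hφ i y
    refine ⟨Q, _, ?_, hQ⟩
    simp only [hS, mem_filter, mem_univ, true_and] at hi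
    exact (mem_union.1 (hcov _)).resolve_left hi
  choose! Q b hb hQ using hQ
  refine (FinProb.pr_mono _ (B := fun ω => ∀ y ∈ Y, ¬ ∀ e ∈ Q y, ω e = true)
    fun ω hω y hy hopen => ?_).trans ?_
  · have hyS := (mem_filter.1 (hYX hy)).1
    simp only [hS, mem_filter, mem_univ, true_and] at hyS
    exact hω _ hyS _ (hb y hy) ((hQ y hy).reachable _ fun e he =>
      mem_edgeSet_openSubgraph.2 ⟨(hQ y hy).sub_edges e he, hopen e he⟩)
  rw [FinProb.pr_pi_forall_dependsOn _ Y (A := fun y ω => ¬ ∀ e ∈ Q y, ω e = true)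
    (I := fun y => (Q y : Set (Sym2 (Fin d → Bool))))]
  · have hp5 : 0 ≤ 1 - p ^ 5 := by have := pow_le_one₀ h0 h1 (n := 5); linarith
    calc ∏ y ∈ Y, (FinProb.pi (Sym2 (Fin d → Bool)) (FinProb.ber p h0 h1)).pr
          (fun ω => ¬ ∀ e ∈ Q y, ω e = true) ≤ ∏ y ∈ Y, (1 - p ^ 5) := by
          refine prod_le_prod (fun _ _ => FinProb.pr_nonneg _ _) fun y hy => ?_
          rw [FinProb.pr_not, FinProb.pr_pi_forall_mem (s := Q y) (B := fun _ b => b = true),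
            prod_const, pr_ber]
          have := pow_le_pow_of_le_one h0 h1 (hQ y hy).card_le
          linarith
      _ = (1 - p ^ 5) ^ Y.card := prod_const _
      _ ≤ (Real.exp (-p ^ 5)) ^ Y.card :=
          pow_le_pow_left₀ hp5 (by have := Real.add_one_le_exp (-p ^ 5); linarith) _
      _ = Real.exp (-(p ^ 5 * Y.card)) := by rw [← Real.exp_nat_mul]; congr 1; ring
      _ ≤ _ := by
          refine Real.exp_le_exp.2 (neg_le_neg ?_)
          rw [mul_div_assoc]
          refine mul_le_mul_of_nonneg_left ?_ (pow_nonneg h0 _)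
          rw [div_le_iff₀ (by positivity)]
          have : m ≤ Y.card * (d + 1) ^ 6 * d := hXm.trans (Nat.mul_le_mul_right _ hYc)
          calc (m : ℝ) ≤ ((Y.card * (d + 1) ^ 6 * d : ℕ) : ℝ) := by exact_mod_cast this
            _ = _ := by push_cast; ring
  · intro y _ ω ω' hω
    refine congrArg Not (propext (forall₂_congr fun e he => ?_))
    rw [hω e (by simpa using he)]
  · intro x hx y hy hxy
    rw [Set.disjoint_left]
    intro e he he'
    have h1 := (hQ x hx).sub_ball e he
    have h2 := (hQ y hy).sub_ball e he'
    have h3 := hsep x hx y hy hxy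
    induction e with
    | _ u w =>
      have h4 : hammingDist x u ≤ 3 := h1 u (by simp)
      have h5 : hammingDist y u ≤ 3 := h2 u (by simp)
      have h6 := hammingDist_triangle x u y
      rw [hammingDist_comm u y] at h6
      omega

/-- Sprinkling connects all the large components of `H`. -/
theorem pr_not_merged_le (hd : 0 < d) {p : ℝ} (h0 : 0 ≤ p) (h1 : p ≤ 1)
    (H : SimpleGraph (Fin d → Bool)) {K N : ℕ}
    (hN : ∀ v, K < (comp H v).card → N ≤ (comp H v).card)
    (hnear : ∀ v, ∃ i j, K < (comp H (toggle i (toggle j v))).card) :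
    (FinProb.pi (Sym2 (Fin d → Bool)) (FinProb.ber p h0 h1)).pr (fun ω => ∃ x y,
      K < (comp H x).card ∧ K < (comp H y).card ∧
        ¬ (H ⊔ openSubgraph (dirCube univ) ω).Reachable x y) ≤
      Real.exp (2 ^ d * Real.exp (-(p ^ 5 * N / (d * (d + 1) ^ 6)))) - 1 := by
  set t := Real.exp (-(p ^ 5 * N / (d * (d + 1) ^ 6))) with ht
  have ht0 : 0 < t := Real.exp_pos _
  set W : Finset (Fin d → Bool) := univ.filter fun v => K < (comp H v).card with hW
  set 𝒞 := W.image (comp H) with h𝒞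
  have hmemW : ∀ {x}, x ∈ W ↔ K < (comp H x).card := by simp [hW]
  have hself : ∀ x, x ∈ comp H x := fun x => mem_comp.2 (SimpleGraph.Reachable.refl _)
  have h𝒞card : 𝒞.card ≤ 2 ^ d := card_image_le.trans ((card_le_univ _).trans (by simp))
  -- a retraction onto the large components
  obtain ⟨φ, hφW, hφid, hφ⟩ : ∃ φ : (Fin d → Bool) → Fin d → Bool, (∀ x, φ x ∈ W) ∧
      (∀ x ∈ W, φ x = x) ∧ ∀ x, φ x = x ∨ ∃ i j, φ x = toggle i (toggle j x) := by
    choose f g hfg using hnear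
    refine ⟨fun x => if x ∈ W then x else toggle (f x) (toggle (g x) x), fun x => ?_, fun x hx => ?_,
      fun x => ?_⟩
    · dsimp only
      split_ifs with h
      · exact h
      · exact hmemW.2 (hfg x)
    · simp [hx]
    · dsimp only
      split_ifs with h
      · exact Or.inl rfl
      · exact Or.inr ⟨_, _, rfl⟩
  have hdisj : ∀ C ∈ 𝒞, ∀ C' ∈ 𝒞, C ≠ C' → Disjoint C C' := by
    intro C hC C' hC' hne
    obtain ⟨x, -, rfl⟩ := mem_image.1 hC
    obtain ⟨y, -, rfl⟩ := mem_image.1 hC'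
    rw [Finset.disjoint_left]
    exact fun z hz hz' => hne (by rw [← comp_eq_of_mem hz, ← comp_eq_of_mem hz'])
  have hsize : ∀ 𝒜 ⊆ 𝒞, N * 𝒜.card ≤ (𝒜.biUnion id).card := by
    intro 𝒜 h𝒜
    rw [card_biUnion (t := id) fun C hC C' hC' hne => hdisj C (h𝒜 hC) C' (h𝒜 hC') hne, mul_comm,
      ← smul_eq_mul]
    refine card_nsmul_le_sum _ _ _ fun C hC => ?_
    obtain ⟨x, hx, rfl⟩ := mem_image.1 (h𝒜 hC)
    exact hN x (hmemW.1 hx)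
  have hmemU : ∀ {𝒜}, 𝒜 ⊆ 𝒞 → ∀ {x}, x ∈ 𝒜.biUnion id ↔ comp H x ∈ 𝒜 := by
    intro 𝒜 h𝒜 x
    simp only [mem_biUnion, id]
    constructor
    · rintro ⟨C, hC, hx⟩
      obtain ⟨y, -, rfl⟩ := mem_image.1 (h𝒜 hC)
      rwa [comp_eq_of_mem hx]
    · exact fun h => ⟨_, h, hself x⟩
  have hUW : ∀ {𝒜}, 𝒜 ⊆ 𝒞 → 𝒜.biUnion id ⊆ W := by
    intro 𝒜 h𝒜 x hx
    obtain ⟨y, hy, hxy⟩ := mem_image.1 (h𝒜 ((hmemU h𝒜).1 hx))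
    rw [hmemW, ← hxy]; exact hmemW.1 hy
  set bad : Finset (Finset (Fin d → Bool)) → (Sym2 (Fin d → Bool) → Bool) → Prop := fun 𝒜 ω =>
    ∀ a ∈ 𝒜.biUnion id, ∀ b ∈ (𝒞 \ 𝒜).biUnion id,
      ¬ (openSubgraph (dirCube univ) ω).Reachable a b with hbad
  set 𝒯 := 𝒞.powerset.filter fun 𝒜 => 𝒜.Nonempty ∧ 𝒜.card ≤ (𝒞 \ 𝒜).card with h𝒯
  have hexists : ∀ ω, (∃ x y, K < (comp H x).card ∧ K < (comp H y).card ∧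
      ¬ (H ⊔ openSubgraph (dirCube univ) ω).Reachable x y) → ∃ 𝒜 ∈ 𝒯, bad 𝒜 ω := by
    rintro ω ⟨x, y, hx, hy, hxy⟩
    set H' := H ⊔ openSubgraph (dirCube univ) ω with hH'
    -- The components reached from `x` and the others form an unjoined division; the family with
    -- fewer components is recorded.
    set 𝒜 := 𝒞.filter fun C => ∀ z ∈ C, H'.Reachable x z with h𝒜
    have h𝒜𝒞 : 𝒜 ⊆ 𝒞 := filter_subset _ _
    have hxA : comp H x ∈ 𝒜 := mem_filter.2 ⟨mem_image_of_mem _ (hmemW.2 hx), fun z hz =>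
      (mem_comp.1 hz).mono le_sup_left⟩
    have hyA : comp H y ∈ 𝒞 \ 𝒜 := Finset.mem_sdiff.2 ⟨mem_image_of_mem _ (hmemW.2 hy), fun h =>
      hxy ((mem_filter.1 h).2 y (hself y))⟩
    have hbadA : bad 𝒜 ω := by
      intro a ha b hb hab
      rw [hmemU h𝒜𝒞] at ha
      rw [hmemU sdiff_subset, Finset.mem_sdiff] at hb
      refine hb.2 (mem_filter.2 ⟨hb.1, fun z hz => ?_⟩)
      exact (((mem_filter.1 ha).2 a (hself a)).trans (hab.mono le_sup_right)).trans
        ((mem_comp.1 hz).mono le_sup_left)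
    rcases le_total 𝒜.card (𝒞 \ 𝒜).card with h | h
    · exact ⟨𝒜, mem_filter.2 ⟨mem_powerset.2 h𝒜𝒞, ⟨_, hxA⟩, h⟩, hbadA⟩
    · refine ⟨𝒞 \ 𝒜, mem_filter.2 ⟨mem_powerset.2 sdiff_subset, ⟨_, hyA⟩, ?_⟩, ?_⟩
      · rwa [Finset.sdiff_sdiff_eq_self h𝒜𝒞]
      · intro a ha b hb hab
        rw [Finset.sdiff_sdiff_eq_self h𝒜𝒞] at hb
        exact hbadA b hb a ha hab.symm
  refine (FinProb.pr_mono _ hexists).trans ((FinProb.pr_exists_le _ 𝒯 bad).trans ?_)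
  have hterm : ∀ 𝒜 ∈ 𝒯, (FinProb.pi (Sym2 (Fin d → Bool)) (FinProb.ber p h0 h1)).pr (bad 𝒜) ≤
      t ^ 𝒜.card := by
    intro 𝒜 h
    simp only [h𝒯, mem_filter, mem_powerset] at h
    obtain ⟨hsub, -, hle⟩ := h
    refine (pr_not_connected_le hd h0 h1 hφ (fun x hx => hφid x (hUW hsub hx))
      (fun x hx => hφid x (hUW sdiff_subset hx)) ?_ (fun x => ?_) (m := N * 𝒜.card) (hsize 𝒜 hsub)
      ((Nat.mul_le_mul_left _ hle).trans (hsize _ sdiff_subset))).trans_eq ?_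
    · rw [Finset.disjoint_left]
      intro x hx hx'
      rw [hmemU hsub] at hx
      rw [hmemU sdiff_subset, Finset.mem_sdiff] at hx'
      exact hx'.2 hx
    · rw [mem_union, hmemU hsub, hmemU sdiff_subset, Finset.mem_sdiff]
      have : comp H (φ x) ∈ 𝒞 := mem_image_of_mem _ (hφW x)
      tauto
    · rw [ht, ← Real.exp_nat_mul]
      congr 1; push_cast; ring
  refine (sum_le_sum hterm).trans ?_
  -- The subsets of `𝒞`, weighted by `t ^ |𝒜|`, sum to `(1 + t) ^ |𝒞|`; leaving out the empty one
  -- gives the `- 1`.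
  have hsub : 𝒯 ⊆ 𝒞.powerset.erase ∅ := by
    intro 𝒜 h
    simp only [h𝒯, mem_filter] at h
    exact mem_erase.2 ⟨h.2.1.ne_empty, h.1⟩
  refine (sum_le_sum_of_subset_of_nonneg hsub fun _ _ _ => pow_nonneg ht0.le _).trans ?_
  have htotal := Finset.sum_pow_mul_eq_add_pow t 1 𝒞
  simp only [one_pow, mul_one] at htotal
  have herase := Finset.sum_erase_add 𝒞.powerset (fun 𝒜 => t ^ 𝒜.card) (empty_mem_powerset 𝒞)
  rw [htotal, card_empty, pow_zero] at herase
  have hexp : (t + 1) ^ 𝒞.card ≤ Real.exp (2 ^ d * t) := by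
    calc (t + 1) ^ 𝒞.card ≤ (Real.exp t) ^ 𝒞.card :=
          pow_le_pow_left₀ (by linarith) (Real.add_one_le_exp t) _
      _ = Real.exp (𝒞.card * t) := (Real.exp_nat_mul t _).symm
      _ ≤ _ := Real.exp_le_exp.2 (mul_le_mul_of_nonneg_right (by exact_mod_cast h𝒞card) ht0.le)
  linarith

end Merging

/-! ### The giant component and its density. -/

section Giant
open Finset
open scoped Classical

/-- Path events at vertices more than `2k` apart depend on disjoint edge sets, so only pairs within
distance `2k` contribute to the variance. -/
theorem variance_count_le {d : ℕ} (P : FinProb Bool) (k : ℕ) {t : ℝ} (ht : 0 < t) :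
    t ^ 2 * (FinProb.pi (Sym2 (Fin d → Bool)) P).pr (fun ω => t ≤
      |FinProb.count univ (fun v ω => LongPath (openSubgraph (dirCube univ) ω) k ∅ v) ω -
        ∑ v, (FinProb.pi (Sym2 (Fin d → Bool)) P).pr
          (fun ω => LongPath (openSubgraph (dirCube univ) ω) k ∅ v)|) ≤
      2 ^ d * (d + 1) ^ (2 * k) := by
  set Q := FinProb.pi (Sym2 (Fin d → Bool)) P with hQ
  refine (mul_le_mul_of_nonneg_left (Q.pr_mono fun ω hω => ?_) (sq_nonneg t)).trans
    ((Q.chebyshev_count univ (fun v ω => LongPath (openSubgraph (dirCube univ) ω) k ∅ v) t).trans ?_)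
  · rw [← sq_abs (_ - _)]
    exact pow_le_pow_left₀ ht.le hω 2
  · have hrow : ∀ u : Fin d → Bool, ∑ v, (Q.pr (fun ω =>
        LongPath (openSubgraph (dirCube univ) ω) k ∅ u ∧
        LongPath (openSubgraph (dirCube univ) ω) k ∅ v) -
        Q.pr (fun ω => LongPath (openSubgraph (dirCube univ) ω) k ∅ u) *
        Q.pr (fun ω => LongPath (openSubgraph (dirCube univ) ω) k ∅ v)) ≤ (d + 1) ^ (2 * k) := by
      intro u
      calc _ ≤ ∑ v, if hammingDist u v ≤ 2 * k then (1 : ℝ) else 0 := ?_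
        _ = ((univ.filter fun v => hammingDist u v ≤ 2 * k).card : ℝ) := by rw [sum_boole]
        _ ≤ _ := by exact_mod_cast card_hammingBall_le u (2 * k)
      refine sum_le_sum fun v _ => ?_
      split_ifs with h
      · have h1 := Q.pr_le_one (fun ω => LongPath (openSubgraph (dirCube univ) ω) k ∅ u ∧
          LongPath (openSubgraph (dirCube univ) ω) k ∅ v)
        have h2 := mul_nonneg (Q.pr_nonneg fun ω => LongPath (openSubgraph (dirCube univ) ω) k ∅ u)
          (Q.pr_nonneg fun ω => LongPath (openSubgraph (dirCube univ) ω) k ∅ v)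
        linarith
      · rw [hQ, FinProb.pr_pi_and P (dependsOn_longPath_ball univ k ∅ u)
          (dependsOn_longPath_ball univ k ∅ v), sub_self]
        rw [Set.disjoint_left]
        intro e he he'
        induction e with
        | _ x y =>
          have h4 : hammingDist u x ≤ k := he x (by simp)
          have h5 : hammingDist v x ≤ k := he' x (by simp)
          have h6 := hammingDist_triangle u x v
          rw [hammingDist_comm x v] at h6
          omega
    refine (sum_le_sum fun u _ => hrow u).trans (le_of_eq ?_)
    simp

theorem ncard_supp_eq {V : Type*} [Fintype V] [DecidableEq V] (H : SimpleGraph V) (v : V) :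
    (H.connectedComponentMk v).supp.ncard = (comp H v).card := by
  rw [← Set.ncard_coe_finset]
  congr 1
  ext w
  rw [SimpleGraph.ConnectedComponent.mem_supp_iff, SimpleGraph.ConnectedComponent.eq, mem_coe,
    mem_comp]
  exact ⟨fun h => h.symm, fun h => h.symm⟩

/-- The deterministic part of the argument. -/
theorem exists_giant {d : ℕ} {ω₁ ω₂ : Sym2 (Fin d → Bool) → Bool} (hω : ω₁ ≤ ω₂) {k K N : ℕ}
    (hKN : 2 * K ≤ N) (hkN : (d + 1) ^ k ≤ N)
    (hmid : ∀ v, ¬ HasMiddleTree (dirCube univ) ω₁ ω₂ K N v)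
    (hnear : ∀ v, ∃ i j, K < (comp (openSubgraph (dirCube univ) ω₁) (toggle i (toggle j v))).card)
    (hmerge : ∀ x y, K < (comp (openSubgraph (dirCube univ) ω₁) x).card →
      K < (comp (openSubgraph (dirCube univ) ω₁) y).card →
      (openSubgraph (dirCube univ) ω₂).Reachable x y) :
    ∃ L₁ : (openSubgraph (dirCube univ) ω₂).ConnectedComponent,
      |(L₁.supp.ncard : ℝ) - FinProb.count univ
        (fun v ω => LongPath (openSubgraph (dirCube univ) ω) k ∅ v) ω₂| ≤
        ((univ.filter fun v => HasMiddleTree (dirCube univ) ω₁ ω₂ k N v).card : ℝ) ∧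
      ∀ L, L ≠ L₁ → L.supp.ncard ≤ K := by
  set H₁ := openSubgraph (dirCube univ) ω₁ with hH₁
  set H₂ := openSubgraph (dirCube univ) ω₂ with hH₂
  obtain ⟨i, j, hx₀⟩ := hnear fun _ => false
  set x₀ := toggle i (toggle j fun _ => false)
  have huniq : ∀ v, K < (comp H₂ v).card → v ∈ comp H₂ x₀ := by
    intro v hv
    rcases exists_large_comp_or_hasMiddleTree hω hKN hv with ⟨w, hw, hwK⟩ | h
    · exact mem_comp.2 ((hmerge x₀ w hx₀ hwK).trans (mem_comp.1 hw).symm)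
    · exact absurd h (hmid v)
  have hbig : N < (comp H₂ x₀).card := by
    have h1 : K < (comp H₂ x₀).card := hx₀.trans_le (card_le_card fun w hw =>
      mem_comp.2 ((mem_comp.1 hw).mono (openSubgraph_mono le_rfl hω)))
    by_contra h2
    exact hmid x₀ (HasMiddleTree.of_card_comp hω le_rfl h1 (not_lt.1 h2))
  refine ⟨H₂.connectedComponentMk x₀, ?_, ?_⟩
  · rw [ncard_supp_eq, FinProb.count]
    set A : Finset (Fin d → Bool) := univ.filter fun v => LongPath H₂ k ∅ v with hA
    set Z : Finset (Fin d → Bool) := univ.filter fun v =>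
      HasMiddleTree (dirCube univ) ω₁ ω₂ k N v with hZ
    have h1 : comp H₂ x₀ ⊆ A := fun v hv => by
      simp only [hA, mem_filter, mem_univ, true_and]
      refine longPath_of_card_comp (openSubgraph_le _ _) ?_
      rw [comp_eq_of_mem hv]; omega
    -- A path of `k` edges forces more than `k` vertices. A component with at most `N` of them gives
    -- a middle tree, and a larger one is the giant.
    have h2 : A ⊆ comp H₂ x₀ ∪ Z := fun v hv => by
      simp only [hA, mem_filter, mem_univ, true_and] at hv
      rw [mem_union]
      by_cases hN : (comp H₂ v).card ≤ N
      · right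
        simp only [hZ, mem_filter, mem_univ, true_and]
        exact HasMiddleTree.of_card_comp hω le_rfl hv.lt_card_comp hN
      · left
        exact huniq v (by omega)
    have h3 := card_le_card h1
    have h4 := (card_le_card h2).trans (card_union_le _ _)
    have h3' : ((comp H₂ x₀).card : ℝ) ≤ A.card := by exact_mod_cast h3
    have h4' : (A.card : ℝ) ≤ (comp H₂ x₀).card + Z.card := by exact_mod_cast h4
    rw [abs_le]
    constructor <;> linarith
  · intro L
    induction L using SimpleGraph.ConnectedComponent.ind with
    | _ v =>
      intro hne
      rw [ncard_supp_eq]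
      by_contra hK
      exact hne (SimpleGraph.ConnectedComponent.eq.2 (mem_comp.1 (huniq v (not_le.1 hK))).symm)

theorem eventually_pow_le {κ b : ℝ} (hκ : 0 < κ) (hb : 0 < b) (n : ℕ) :
    ∀ᶠ d : ℕ in atTop, ((d : ℝ) + 1) ^ n ≤ b * 2 ^ ⌊κ * d⌋₊ := by
  have hlog := Real.log_pos one_lt_two
  have h1 := (Real.tendsto_pow_mul_exp_neg_atTop_nhds_zero n).comp
    ((tendsto_natCast_atTop_atTop (R := ℝ)).const_mul_atTop (show 0 < κ * Real.log 2 by positivity))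
  set ρ := κ * Real.log 2 with hρ
  have hρ0 : 0 < ρ := by positivity
  have hcst : 0 < b / 2 * (ρ / 2) ^ n := by positivity
  filter_upwards [h1.eventually (gt_mem_nhds hcst), eventually_ge_atTop 1] with d hd hd1
  simp only [Function.comp] at hd
  have hd1' : (1 : ℝ) ≤ d := by exact_mod_cast hd1
  have hfl : κ * d < (⌊κ * d⌋₊ : ℝ) + 1 := Nat.lt_floor_add_one _
  have h2 : Real.exp (ρ * d) ≤ 2 * 2 ^ ⌊κ * d⌋₊ := by
    have : (2 : ℝ) * 2 ^ ⌊κ * d⌋₊ = Real.exp (Real.log 2 * (⌊κ * d⌋₊ + 1)) := by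
      rw [← pow_succ', mul_comm (Real.log 2), ← Nat.cast_succ, Real.exp_nat_mul, Real.exp_log two_pos]
    rw [this]
    refine Real.exp_le_exp.2 ?_
    rw [hρ]; nlinarith
  rw [Real.exp_neg] at hd
  have hexp := Real.exp_pos (ρ * d)
  rw [← div_eq_mul_inv, div_lt_iff₀ hexp] at hd
  have h3 : (ρ / 2) ^ n * ((d : ℝ) + 1) ^ n ≤ (ρ * d) ^ n := by
    rw [← mul_pow]
    exact pow_le_pow_left₀ (by positivity) (by nlinarith) _
  have h4 : (ρ / 2) ^ n * ((d : ℝ) + 1) ^ n ≤ (ρ / 2) ^ n * (b * 2 ^ ⌊κ * d⌋₊) := by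
    calc _ ≤ (ρ * d) ^ n := h3
      _ ≤ b / 2 * (ρ / 2) ^ n * Real.exp (ρ * d) := hd.le
      _ ≤ b / 2 * (ρ / 2) ^ n * (2 * 2 ^ ⌊κ * d⌋₊) := mul_le_mul_of_nonneg_left h2 hcst.le
      _ = _ := by ring
  exact le_of_mul_le_mul_left h4 (by positivity)

theorem eventually_geom_le {θ γ : ℝ} (h0 : 0 ≤ θ) (h1 : θ < 1) (hγ : 0 < γ) :
    ∀ᶠ d : ℕ in atTop, θ ^ d ≤ γ :=
  ((tendsto_pow_atTop_nhds_zero_of_lt_one h0 h1).eventually (gt_mem_nhds hγ)).mono fun _ h => h.le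

theorem exists_tail_le {β γ : ℝ} (hβ : 0 < β) (hγ : 0 < γ) :
    ∃ k₀ : ℕ, ∀ k ≥ k₀, Real.exp (-β) ^ (k + 1) / (1 - Real.exp (-β)) ≤ γ := by
  have hb1 : Real.exp (-β) < 1 := by
    rw [← Real.exp_zero]; exact Real.exp_lt_exp.2 (by linarith)
  have h2 : 0 < 1 - Real.exp (-β) := by linarith
  obtain ⟨k₀, hk⟩ := eventually_atTop.1
    (eventually_geom_le (Real.exp_pos (-β)).le hb1 (mul_pos hγ h2))
  exact ⟨k₀, fun k hkk => by rw [div_le_iff₀ h2]; exact hk (k + 1) (by omega)⟩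

/-- In every subcube of almost full dimension, a vertex lies in a component of more than `d / I`
vertices with probability bounded below. -/
theorem eventually_large_comp {c κ β I : ℝ} (hc : 1 < c) (hκ0 : 0 < κ) (hκ1 : κ < 1 / 2)
    (hβ0 : 0 < β) (hβ : β < (1 - κ) * (1 - 2 * κ) * c - 1 - Real.log c) (hI : 0 < I) :
    ∃ α : ℝ, 0 < α ∧ α ≤ 1 ∧ ∀ᶠ d : ℕ in atTop, ∀ p : ℝ, ∀ h0 : 0 ≤ p, ∀ h1 : p ≤ 1,
      p = (1 - κ) * c / d → ∀ J : Finset (Fin d), (1 - κ) * d ≤ J.card → ∀ w,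
      α ≤ (FinProb.pi (Sym2 (Fin d → Bool)) (FinProb.ber p h0 h1)).pr fun ω =>
        ⌊d / I⌋₊ < (comp (openSubgraph (dirCube J) ω) w).card := by
  have hlogc := Real.log_pos hc
  -- One factor `1 - κ` is the reduced density, the other the reduced dimension; the branching
  -- process stays supercritical because of `hβ`.
  have hc' : 1 < (1 - κ) * (1 - κ) * c := by
    have : 0 ≤ (1 - κ) * κ * c := by
      refine mul_nonneg (mul_nonneg ?_ ?_) ?_ <;> linarith
    linarith
  obtain ⟨y, hy0, hy1, -, -, -, hyk⟩ := exists_survival_limit hc'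
  obtain ⟨k, hk⟩ := exists_tail_le hβ0 (show 0 < y / 4 by positivity)
  obtain ⟨n₀, hn₀⟩ := le_pr_geoPath (c := (1 - κ) * (1 - κ) * c) (C := c) (by linarith) k (y / 4)
    (by positivity) 0
  refine ⟨y / 2, by positivity, by linarith, ?_⟩
  filter_upwards [pr_hasMiddleTree_le hc hκ0 hκ1 hβ0 hβ (X := Bool), eventually_pow_le hκ0 hI 1,
    eventually_ge_atTop ⌈n₀ / (1 - κ)⌉₊, eventually_gt_atTop 0] with
    d hmid hN hdn hd p h0 h1 hp J hJ w
  have hκ' : 0 < 1 - κ := by linarith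
  have hdn' : (n₀ : ℝ) / (1 - κ) ≤ d := (Nat.le_ceil _).trans (by exact_mod_cast hdn)
  rw [div_le_iff₀ hκ'] at hdn'
  have hd0 : (0 : ℝ) < d := by exact_mod_cast hd
  have hKN : ⌊d / I⌋₊ ≤ 2 ^ ⌊κ * d⌋₊ := by
    have : (⌊d / I⌋₊ : ℝ) ≤ ((2 ^ ⌊κ * d⌋₊ : ℕ) : ℝ) := by
      refine (Nat.floor_le (by positivity)).trans ?_
      rw [div_le_iff₀ hI]
      push_cast
      linarith
    exact_mod_cast this
  have hpd : p * d = (1 - κ) * c := by rw [hp]; field_simp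
  have hJd : (J.card : ℝ) ≤ d := by
    have := card_le_univ J
    rw [Fintype.card_fin] at this
    exact_mod_cast this
  have hcκ : (1 - κ) * c ≤ c := by
    have := mul_pos hκ0 (show 0 < c by linarith)
    linarith
  have e1 : (1 - κ) * (1 - κ) * c ≤ J.card * p := by
    calc (1 - κ) * (1 - κ) * c = (1 - κ) * d * p := by rw [mul_assoc (1 - κ) _ p, mul_comm _ p, hpd]; ring
      _ ≤ _ := mul_le_mul_of_nonneg_right hJ h0
  have e2 : p * J.card ≤ c := (mul_le_mul_of_nonneg_left hJd h0).trans (hpd.trans_le hcκ)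
  have hnJ : n₀ ≤ J.card := by
    have : (n₀ : ℝ) ≤ J.card := by linarith
    exact_mod_cast this
  have hg := hn₀ J.card hnJ d p h0 h1 J w le_rfl e1 e2
  have hmw := hmid (FinProb.ber p h0 h1) (fun b => b) (fun b => b) (by
      rw [pr_ber, hp]
      exact div_le_div_of_nonneg_right hcκ hd0.le) (by rw [pr_ber, hp]) J hJ w k
  have hor := (FinProb.pr_mono (FinProb.pi (Sym2 (Fin d → Bool)) (FinProb.ber p h0 h1))
    (A := fun ω => GeoPath ω k J w)
    (B := fun ω => ⌊d / I⌋₊ < (comp (openSubgraph (dirCube J) ω) w).card ∨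
      HasMiddleTree (dirCube J) (fun e => ω e) (fun e => ω e) k (2 ^ ⌊κ * d⌋₊) w) fun ω hω => by
      by_cases h : ⌊d / I⌋₊ < (comp (openSubgraph (dirCube J) ω) w).card
      · exact Or.inl h
      · have hlp := hω.longPath (J₀ := J) (A := ∅) subset_rfl (by simp)
        exact Or.inr (HasMiddleTree.of_card_comp (ω := ω) (le_refl ω) (le_refl ω)
          hlp.lt_card_comp ((not_lt.1 h).trans hKN))).trans (FinProb.pr_or_le _ _ _)
  have h2 := hyk k
  have h3 := hk k le_rfl
  linarith

/-- With probability close to one, every vertex is at distance two from a vertex in a large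
component. -/
theorem eventually_near {c κ β I : ℝ} (hc : 1 < c) (hκ0 : 0 < κ) (hκ1 : κ < 1 / 2) (hβ0 : 0 < β)
    (hβ : β < (1 - κ) * (1 - 2 * κ) * c - 1 - Real.log c) (hI : 0 < I) {γ : ℝ} (hγ : 0 < γ) :
    ∀ᶠ d : ℕ in atTop, ∀ p : ℝ, ∀ h0 : 0 ≤ p, ∀ h1 : p ≤ 1, p = (1 - κ) * c / d →
      (FinProb.pi (Sym2 (Fin d → Bool)) (FinProb.ber p h0 h1)).pr (fun ω => ∃ v, ¬ ∃ i j,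
        ⌊d / I⌋₊ < (comp (openSubgraph (dirCube univ) ω) (toggle i (toggle j v))).card) ≤ γ := by
  obtain ⟨α, hα0, hα1, hα⟩ := eventually_large_comp hc hκ0 hκ1 hβ0 hβ hI
  -- With `m` about `κ d / 2` flips on each side there are `m ^ 2 ≥ r d` trials, so a vertex fails
  -- with probability at most `4 ^ (-d)`, which leaves `2 ^ (-d)` after the union bound.
  obtain ⟨r, hr⟩ : ∃ r : ℕ, (1 - α) ^ r ≤ 1 / 4 :=
    (eventually_geom_le (show 0 ≤ 1 - α by linarith) (by linarith) (by norm_num)).exists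
  filter_upwards [hα, eventually_ge_atTop ⌈4 / κ⌉₊, eventually_ge_atTop ⌈16 * r / κ ^ 2⌉₊,
    eventually_geom_le (show (0 : ℝ) ≤ 1 / 2 by norm_num) (by norm_num) hγ] with
    d hlow hd4 hdr hdγ p h0 h1 hp
  have hd4' : 4 / κ ≤ (d : ℝ) := (Nat.le_ceil _).trans (by exact_mod_cast hd4)
  have hdr' : 16 * r / κ ^ 2 ≤ (d : ℝ) := (Nat.le_ceil _).trans (by exact_mod_cast hdr)
  rw [div_le_iff₀ (by positivity)] at hd4' hdr'
  have hd0 : (0 : ℝ) ≤ d := Nat.cast_nonneg d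
  have hκd : κ * d ≤ d := by
    have := mul_le_mul_of_nonneg_right (show κ ≤ 1 by linarith) hd0
    linarith
  set m := ⌊κ * d / 2⌋₊ with hm
  have hm1 : (m : ℝ) ≤ κ * d / 2 := Nat.floor_le (by positivity)
  have hm2 : κ * d / 4 ≤ m := by
    have : κ * d / 2 < (m : ℝ) + 1 := Nat.lt_floor_add_one _
    linarith
  have hmd : m + m ≤ d := by
    have : (m : ℝ) + m ≤ d := by linarith
    exact_mod_cast this
  obtain ⟨D, -, hD⟩ := exists_subset_card_eq (s := (univ : Finset (Fin d))) (n := m + m) (by simpa)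
  obtain ⟨D₁, hD₁, hcD₁⟩ := exists_subset_card_eq (s := D) (n := m) (by omega)
  have hcD₂ : (D \ D₁).card = m := by rw [card_sdiff_of_subset hD₁]; omega
  have hdis : Disjoint D₁ (D \ D₁) := disjoint_sdiff
  have hJc : (univ \ (D₁ ∪ D \ D₁)).card + (m + m) = d := by
    rw [card_sdiff_of_subset (subset_univ _), card_union_of_disjoint hdis, hcD₁, hcD₂,
      card_univ, Fintype.card_fin]
    omega
  have hJr : ((univ \ (D₁ ∪ D \ D₁)).card : ℝ) + (m + m) = d := by exact_mod_cast hJc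
  have hJκ : (1 - κ) * d ≤ (univ \ (D₁ ∪ D \ D₁)).card := by linarith
  have hv : ∀ v, (FinProb.pi (Sym2 (Fin d → Bool)) (FinProb.ber p h0 h1)).pr (fun ω => ¬ ∃ i j,
      ⌊d / I⌋₊ < (comp (openSubgraph (dirCube univ) ω) (toggle i (toggle j v))).card) ≤
      (1 / 4) ^ d := by
    intro v
    refine (pr_no_large_comp_near_le _ hdis v _ (hlow p h0 h1 hp _ hJκ)).trans ?_
    rw [hcD₁, hcD₂]
    have hrm : r * d ≤ m * m := by
      have h5 : (κ * d / 4) * (κ * d / 4) ≤ (m : ℝ) * m :=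
        mul_le_mul hm2 hm2 (by positivity) (Nat.cast_nonneg _)
      have h6 := mul_le_mul_of_nonneg_right hdr' hd0
      have h7 : (r : ℝ) * d ≤ (m : ℝ) * m := by linarith
      exact_mod_cast h7
    calc (1 - α) ^ (m * m) ≤ (1 - α) ^ (r * d) :=
          pow_le_pow_of_le_one (by linarith) (by linarith) hrm
      _ = ((1 - α) ^ r) ^ d := pow_mul _ _ _
      _ ≤ _ := pow_le_pow_left₀ (pow_nonneg (by linarith) _) hr _
  refine (FinProb.pr_mono _ fun ω hω => ?_).trans ((FinProb.pr_exists_le _ univ fun v ω => ¬ ∃ i j,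
    ⌊d / I⌋₊ < (comp (openSubgraph (dirCube univ) ω) (toggle i (toggle j v))).card).trans
    ((sum_le_sum fun v _ => hv v).trans ?_))
  · obtain ⟨v, hv⟩ := hω
    exact ⟨v, mem_univ v, hv⟩
  · simp only [sum_const, card_univ, Fintype.card_fun, Fintype.card_bool, Fintype.card_fin,
      nsmul_eq_mul]
    push_cast
    rw [← mul_pow]
    refine le_trans (le_of_eq ?_) hdγ
    norm_num

/-- The expected proportion of vertices from which a path of `k` edges starts. -/
theorem eventually_abs_pr_longPath_sub_le {c : ℝ} (hc : 0 < c) (k : ℕ) {η : ℝ} (hη : 0 < η) :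
    ∀ᶠ d : ℕ in atTop, ∀ p : ℝ, ∀ h0 : 0 ≤ p, ∀ h1 : p ≤ 1, p = c / d → ∀ v,
      |(FinProb.pi (Sym2 (Fin d → Bool)) (FinProb.ber p h0 h1)).pr
        (fun ω => LongPath (openSubgraph (dirCube univ) ω) k ∅ v) - survival c k| ≤ η := by
  obtain ⟨n₀, hn₀⟩ := le_pr_geoPath (c := c) (C := c) hc.le k η hη 0
  filter_upwards [eventually_ge_atTop n₀, eventually_gt_atTop 0,
    (tendsto_pathBound c k).eventually (gt_mem_nhds (show survival c k < survival c k + η by linarith))]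
    with d hd hd0 hub p h0 h1 hp v
  have hd0' : (0 : ℝ) < d := by exact_mod_cast hd0
  have hpd : p * d = c := by rw [hp]; field_simp
  have h2 := pr_longPath_le (G := dirCube univ) (D := d) (fun x => degree_dirCube_le univ x) h0 h1 k
    (A := ∅) (v := v) (by simp)
  have h3 := hn₀ d hd d p h0 h1 univ v (by simp) (by linarith) (by simp [hpd])
  have h4 : (FinProb.pi (Sym2 (Fin d → Bool)) (FinProb.ber p h0 h1)).pr
      (fun ω => GeoPath ω k univ v) ≤ (FinProb.pi (Sym2 (Fin d → Bool)) (FinProb.ber p h0 h1)).pr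
      (fun ω => LongPath (openSubgraph (dirCube univ) ω) k ∅ v) :=
    FinProb.pr_mono _ fun ω hω => hω.longPath subset_rfl (by simp)
  rw [← hp] at hub
  rw [abs_le]
  constructor <;> linarith

end Giant

/-! ### Choice of constants and the union of exceptional events. -/

section Assembly
open Finset
open scoped Classical

theorem map_or_ber {p₁ p₂ p : ℝ} (h10 : 0 ≤ p₁) (h11 : p₁ ≤ 1) (h20 : 0 ≤ p₂) (h21 : p₂ ≤ 1)
    (h0 : 0 ≤ p) (h1 : p ≤ 1) (hp : p₁ + p₂ - p₁ * p₂ = p) :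
    ((FinProb.ber p₁ h10 h11).prod (FinProb.ber p₂ h20 h21)).map (fun x => x.1 || x.2) =
      FinProb.ber p h0 h1 := by
  refine FinProb.ext_w (funext fun b => ?_)
  rw [FinProb.w_map]
  cases b <;> simp [FinProb.pr, FinProb.ex, FinProb.prod, FinProb.ber, Fintype.sum_prod_type, ← hp] <;>
    ring

theorem map_fst_ber {p₁ p₂ : ℝ} (h10 : 0 ≤ p₁) (h11 : p₁ ≤ 1) (h20 : 0 ≤ p₂) (h21 : p₂ ≤ 1) :
    ((FinProb.ber p₁ h10 h11).prod (FinProb.ber p₂ h20 h21)).map Prod.fst =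
      FinProb.ber p₁ h10 h11 := by
  refine FinProb.ext_w (funext fun b => ?_)
  rw [FinProb.w_map]
  cases b <;> simp [FinProb.pr, FinProb.ex, FinProb.prod, FinProb.ber, Fintype.sum_prod_type] <;>
    ring

/-- At size `d / I` the tree bound is at most `exp (-3 d / 4)` up to a constant, and `2 exp (-3 / 4)
< 1`. -/
theorem eventually_middle_sum_le {β I γ : ℝ} (hI : 0 < I) (hβ : 3 / 4 * I ≤ β) (hγ : 0 < γ) :
    ∀ᶠ d : ℕ in atTop, 2 ^ d * (Real.exp (-β) ^ (⌊d / I⌋₊ + 1) / (1 - Real.exp (-β))) ≤ γ := by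
  have hβ0 : 0 < β := lt_of_lt_of_le (by positivity) hβ
  have hb1 : Real.exp (-β) < 1 := by
    rw [← Real.exp_zero]; exact Real.exp_lt_exp.2 (by linarith)
  have h2 : 0 < 1 - Real.exp (-β) := by linarith
  have hθ : 2 * Real.exp (-(3 / 4)) < 1 := by
    rw [← Real.exp_log (show (0 : ℝ) < 2 by norm_num), ← Real.exp_add, ← Real.exp_zero]
    exact Real.exp_lt_exp.2 (by have := Real.log_two_lt_d9; linarith)
  filter_upwards [eventually_geom_le (by positivity) hθ (mul_pos hγ h2)] with d hd
  rw [← mul_div_assoc, div_le_iff₀ h2]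
  refine le_trans ?_ hd
  rw [mul_pow]
  refine mul_le_mul_of_nonneg_left ?_ (by positivity)
  rw [← Real.exp_nat_mul, ← Real.exp_nat_mul]
  refine Real.exp_le_exp.2 ?_
  have h3 : (d : ℝ) / I ≤ (⌊(d : ℝ) / I⌋₊ + 1 : ℕ) := by
    push_cast; exact (Nat.lt_floor_add_one _).le
  rw [div_le_iff₀ hI] at h3
  have h4 := mul_le_mul_of_nonneg_left hβ (Nat.cast_nonneg (α := ℝ) (⌊(d : ℝ) / I⌋₊ + 1))
  linarith

theorem eventually_merge_bound_le {κ γ : ℝ} (hκ : 0 < κ) (hγ : 0 < γ) :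
    ∀ᶠ d : ℕ in atTop, ∀ p : ℝ, κ / d ≤ p →
      Real.exp (2 ^ d * Real.exp (-(p ^ 5 * (2 ^ ⌊κ * d⌋₊ : ℕ) / (d * (d + 1) ^ 6)))) - 1 ≤ γ := by
  have hθ : 2 * Real.exp (-1) < 1 := by
    rw [← Real.exp_log (show (0 : ℝ) < 2 by norm_num), ← Real.exp_add]
    exact (Real.exp_lt_exp.2 (by have := Real.log_two_lt_d9; linarith)).trans_eq Real.exp_zero
  filter_upwards [eventually_geom_le (by positivity) hθ (Real.log_pos (show 1 < 1 + γ by linarith)),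
    eventually_pow_le hκ (show 0 < κ ^ 5 by positivity) 13, eventually_gt_atTop 0] with d hd hN hd0 p hp
  have hd0' : (0 : ℝ) < d := by exact_mod_cast hd0
  have hx : (d : ℝ) ≤ p ^ 5 * (2 ^ ⌊κ * d⌋₊ : ℕ) / (d * (d + 1) ^ 6) := by
    rw [le_div_iff₀ (by positivity)]
    push_cast
    calc (d : ℝ) * (d * (d + 1) ^ 6) ≤ ((d : ℝ) + 1) ^ 13 / (d : ℝ) ^ 5 := by
          rw [le_div_iff₀ (by positivity)]
          calc (d : ℝ) * (d * (d + 1) ^ 6) * (d : ℝ) ^ 5 = (d : ℝ) ^ 7 * ((d : ℝ) + 1) ^ 6 := by ring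
            _ ≤ ((d : ℝ) + 1) ^ 7 * ((d : ℝ) + 1) ^ 6 := by gcongr; linarith
            _ = _ := by ring
      _ ≤ κ ^ 5 * 2 ^ ⌊κ * d⌋₊ / d ^ 5 := by gcongr
      _ = (κ / d) ^ 5 * 2 ^ ⌊κ * d⌋₊ := by rw [div_pow]; ring
      _ ≤ p ^ 5 * 2 ^ ⌊κ * d⌋₊ := by gcongr
  have h2 : 2 ^ d * Real.exp (-(p ^ 5 * (2 ^ ⌊κ * d⌋₊ : ℕ) / (d * (d + 1) ^ 6))) ≤
      Real.log (1 + γ) := by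
    refine le_trans ?_ hd
    rw [mul_pow, ← Real.exp_nat_mul]
    refine mul_le_mul_of_nonneg_left (Real.exp_le_exp.2 ?_) (by positivity)
    linarith
  have := Real.exp_le_exp.2 h2
  rw [Real.exp_log (by linarith)] at this
  linarith

theorem eventually_giant {c : ℝ} (hc : 1 < c) {y : ℝ} (hy : 0 < y)
    (hlim : Tendsto (survival c) atTop (𝓝 y)) {ε γ : ℝ} (hε : 0 < ε) (hγ : 0 < γ) :
    ∀ᶠ d : ℕ in atTop, ∀ p : ℝ, ∀ h0 : 0 ≤ p, ∀ h1 : p ≤ 1, p = c / d →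
      1 - γ ≤ (FinProb.pi (Sym2 (Fin d → Bool)) (FinProb.ber p h0 h1)).pr fun ω =>
        ∃ L₁ : (openSubgraph (dirCube univ) ω).ConnectedComponent,
          |(L₁.supp.ncard : ℝ) - y * 2 ^ d| ≤ ε * (y * 2 ^ d) ∧
          ∀ L, L ≠ L₁ → (L.supp.ncard : ℝ) ≤ d / (c - 1 - Real.log c) := by
  set I := c - 1 - Real.log c with hI
  have hc0 : 0 < c := by linarith
  have hI0 : 0 < I := by
    have := Real.log_lt_sub_one_of_pos hc0 hc.ne'
    linarith
  have hlogc := Real.log_pos hc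
  -- The loss in the exponent is at most `3 κ c = 3 I / 13 < I / 4`, which leaves room for `β = 3 I
  -- / 4`.
  set κ := I / (13 * c) with hκ
  have hκ0 : 0 < κ := by positivity
  have hκc : κ * c = I / 13 := by rw [hκ]; field_simp
  have hκ1 : κ < 1 / 2 := by rw [hκ, div_lt_iff₀ (by positivity)]; linarith
  set β := 3 / 4 * I with hβ
  have hβ0 : 0 < β := by positivity
  have hβI : β < (1 - κ) * (1 - 2 * κ) * c - 1 - Real.log c := by
    have : 0 ≤ κ * (κ * c) := by positivity
    have e : (1 - κ) * (1 - 2 * κ) * c = c - 3 * (κ * c) + 2 * (κ * (κ * c)) := by ring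
    rw [e, hκc] at *
    linarith
  -- Three errors of `η * 2 ^ d`: giant against count, count against mean, mean against `y * 2 ^ d`.
  set η := ε * y / 3 with hη
  have hη0 : 0 < η := by positivity
  -- the cut-off between short and long paths
  obtain ⟨k₁, hk₁⟩ := exists_tail_le hβ0 (show 0 < γ / 5 * η by positivity)
  obtain ⟨k₂, hk₂⟩ := (Metric.tendsto_atTop.1 hlim) (η / 2) (by positivity)
  set k := max k₁ k₂
  have hkβ := hk₁ k (le_max_left _ _)
  have hky : |survival c k - y| < η / 2 := hk₂ k (le_max_right _ _)
  have hγ5 : 0 < γ / 5 := by positivity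
  filter_upwards [pr_hasMiddleTree_le hc hκ0 hκ1 hβ0 hβI (X := Bool × Bool),
    eventually_middle_sum_le hI0 (le_refl β) hγ5, eventually_near hc hκ0 hκ1 hβ0 hβI hI0 hγ5,
    eventually_merge_bound_le hκ0 hγ5, eventually_abs_pr_longPath_sub_le hc0 k (half_pos hη0),
    eventually_pow_le hκ0 (show 0 < I / 2 by positivity) 1, eventually_pow_le hκ0 one_pos k,
    eventually_pow_le (show 0 < 1 / 2 * (1 : ℝ) by norm_num) (show 0 < γ / 5 * η ^ 2 by positivity)
      (2 * k), eventually_gt_atTop 0] with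
    d hmid hmidsum hnear hmerge hmean hKN hkN hvar hd p h0 h1 hp
  have hd0 : (0 : ℝ) < d := by exact_mod_cast hd
  set K := ⌊d / I⌋₊ with hK
  set N := 2 ^ ⌊κ * d⌋₊ with hN
  set G := dirCube (univ : Finset (Fin d)) with hG
  have hKN' : 2 * K ≤ N := by
    have h1 : (K : ℝ) ≤ d / I := Nat.floor_le (by positivity)
    rw [le_div_iff₀ hI0] at h1
    have h2 : (2 * K : ℝ) * I ≤ N * I := by rw [hN]; push_cast; linarith
    exact_mod_cast le_of_mul_le_mul_right h2 hI0
  have hkN' : (d + 1) ^ k ≤ N := by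
    rw [one_mul] at hkN
    exact_mod_cast hkN
  -- the two layers
  set p₁ := (1 - κ) * c / d with hp₁
  have hpp₁ : p - p₁ = κ * c / d := by rw [hp, hp₁]; ring
  have hp₁lt : p₁ < p := by
    have : 0 < κ * c / d := by positivity
    linarith
  have h10 : 0 ≤ p₁ := div_nonneg (mul_nonneg (by linarith) hc0.le) hd0.le
  have h11 : p₁ ≤ 1 := by linarith
  have hp₁1 : 0 < 1 - p₁ := by linarith
  -- Chosen so that an edge open in at least one of the independent layers has probability exactly
  -- `p`.
  set p₂ := (p - p₁) / (1 - p₁) with hp₂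
  have h20 : 0 ≤ p₂ := div_nonneg (by linarith) hp₁1.le
  have h21 : p₂ ≤ 1 := by rw [hp₂, div_le_one hp₁1]; linarith
  have hp₂κ : κ / d ≤ p₂ := by
    rw [hp₂, le_div_iff₀ hp₁1, hpp₁]
    have h3 : κ / d * (1 - p₁) ≤ κ / d * 1 := mul_le_mul_of_nonneg_left (by linarith) (by positivity)
    have h4 : κ / d * 1 ≤ κ / d * c := mul_le_mul_of_nonneg_left hc.le (by positivity)
    calc _ ≤ κ / d * c := h3.trans h4
      _ = _ := by ring
  have hpsum : p₁ + p₂ - p₁ * p₂ = p := by rw [hp₂]; field_simp; ring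
  set P := (FinProb.ber p₁ h10 h11).prod (FinProb.ber p₂ h20 h21) with hP
  have hor := map_or_ber h10 h11 h20 h21 h0 h1 hpsum
  have hfst := map_fst_ber h10 h11 h20 h21
  rw [← hP] at hor hfst
  set Q := FinProb.pi (Sym2 (Fin d → Bool)) P with hQ
  set ℓ₁ : (Sym2 (Fin d → Bool) → Bool × Bool) → Sym2 (Fin d → Bool) → Bool :=
    fun ω e => (ω e).1 with hℓ₁
  set ℓ₂ : (Sym2 (Fin d → Bool) → Bool × Bool) → Sym2 (Fin d → Bool) → Bool :=
    fun ω e => (ω e).1 || (ω e).2 with hℓ₂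
  have hle : ∀ ω, ℓ₁ ω ≤ ℓ₂ ω := fun ω e => by
    simp only [hℓ₁, hℓ₂]; cases (ω e).1 <;> simp
  have hmap₁ : ∀ A, (FinProb.pi (Sym2 (Fin d → Bool)) (FinProb.ber p₁ h10 h11)).pr A =
      Q.pr fun ω => A (ℓ₁ ω) := fun A => by
    rw [← hfst, ← FinProb.map_pi, FinProb.pr_map]
  have hmap₂ : ∀ A, (FinProb.pi (Sym2 (Fin d → Bool)) (FinProb.ber p h0 h1)).pr A =
      Q.pr fun ω => A (ℓ₂ ω) := fun A => by
    rw [← hor, ← FinProb.map_pi, FinProb.pr_map]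
  have hO₁ : P.pr (fun x => x.1 = true) = p₁ := by
    rw [← FinProb.pr_map P Prod.fst fun b => b = true, hfst, pr_ber]
  have hO₂ : P.pr (fun x => (x.1 || x.2) = true) = p := by
    rw [← FinProb.pr_map P (fun x => x.1 || x.2) fun b => b = true, hor, pr_ber]
  have hmid' := hmid P (fun x => x.1) (fun x => x.1 || x.2) (by rw [hO₂, hp]) (by rw [hO₁]) univ
    (by simp only [card_univ, Fintype.card_fin]; linarith [mul_pos hκ0 hd0])
  have hcardV : ((univ : Finset (Fin d → Bool)).card : ℝ) = 2 ^ d := by simp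
  -- the exceptional events
  have b1 : Q.pr (fun ω => ∃ v, HasMiddleTree G (ℓ₁ ω) (ℓ₂ ω) K N v) ≤ γ / 5 := by
    refine (Q.pr_mono fun ω ⟨v, hv⟩ => ⟨v, mem_univ v, hv⟩).trans ((Q.pr_exists_le univ
      fun v ω => HasMiddleTree G (ℓ₁ ω) (ℓ₂ ω) K N v).trans
      ((sum_le_sum fun v _ => hmid' v K).trans ?_))
    rw [sum_const, nsmul_eq_mul, hcardV]
    exact hmidsum
  have b2 : Q.pr (fun ω => ∃ v, ¬ ∃ i j,
      K < (comp (openSubgraph G (ℓ₁ ω)) (toggle i (toggle j v))).card) ≤ γ / 5 := by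
    have := hnear p₁ h10 h11 hp₁
    rwa [hmap₁] at this
  have b3 : Q.pr (fun ω => ((∀ v, K < (comp (openSubgraph G (ℓ₁ ω)) v).card →
      N ≤ (comp (openSubgraph G (ℓ₁ ω)) v).card) ∧
      ∀ v, ∃ i j, K < (comp (openSubgraph G (ℓ₁ ω)) (toggle i (toggle j v))).card) ∧
      ∃ x y, K < (comp (openSubgraph G (ℓ₁ ω)) x).card ∧ K < (comp (openSubgraph G (ℓ₁ ω)) y).card ∧
        ¬ (openSubgraph G (ℓ₁ ω) ⊔ openSubgraph G (fun e => (ω e).2)).Reachable x y) ≤ γ / 5 := by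
    have := FinProb.pr_pi_prod (ι := Sym2 (Fin d → Bool)) (FinProb.ber p₁ h10 h11)
      (FinProb.ber p₂ h20 h21) fun η η' => ((∀ v, K < (comp (openSubgraph G η) v).card →
      N ≤ (comp (openSubgraph G η) v).card) ∧
      ∀ v, ∃ i j, K < (comp (openSubgraph G η) (toggle i (toggle j v))).card) ∧
      ∃ x y, K < (comp (openSubgraph G η) x).card ∧ K < (comp (openSubgraph G η) y).card ∧
        ¬ (openSubgraph G η ⊔ openSubgraph G η').Reachable x y
    refine this.trans_le ?_
    refine le_trans (FinProb.ex_mono _ fun η => ?_) (FinProb.ex_const _ (γ / 5)).le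
    by_cases h : (∀ v, K < (comp (openSubgraph G η) v).card →
      N ≤ (comp (openSubgraph G η) v).card) ∧
      ∀ v, ∃ i j, K < (comp (openSubgraph G η) (toggle i (toggle j v))).card
    · exact (FinProb.pr_mono _ fun η' h' => h'.2).trans
        ((pr_not_merged_le hd h20 h21 (openSubgraph G η) h.1 h.2).trans (hmerge p₂ hp₂κ))
    · rw [FinProb.pr_congr (B := fun _ => False), FinProb.pr_false]
      · exact hγ5.le
      · exact fun η' => iff_of_false (fun h' => h h'.1) id
  set m := ∑ v, (FinProb.pi (Sym2 (Fin d → Bool)) (FinProb.ber p h0 h1)).pr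
    (fun ω => LongPath (openSubgraph G ω) k ∅ v) with hm
  set cnt := FinProb.count univ
    fun v (ω : Sym2 (Fin d → Bool) → Bool) => LongPath (openSubgraph G ω) k ∅ v with hcnt
  have b4 : Q.pr (fun ω => η * 2 ^ d ≤ |cnt (ℓ₂ ω) - m|) ≤ γ / 5 := by
    have ht : 0 < η * 2 ^ d := by positivity
    have h3 := variance_count_le (d := d) (FinProb.ber p h0 h1) k ht
    rw [hmap₂] at h3
    have h4 : ((d : ℝ) + 1) ^ (2 * k) ≤ γ / 5 * η ^ 2 * 2 ^ d := by
      refine hvar.trans (mul_le_mul_of_nonneg_left (pow_le_pow_right₀ one_le_two ?_) (by positivity))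
      refine Nat.floor_le_of_le ?_
      linarith
    have h5 : (η * 2 ^ d) ^ 2 * Q.pr (fun ω => η * 2 ^ d ≤ |cnt (ℓ₂ ω) - m|) ≤
        (η * 2 ^ d) ^ 2 * (γ / 5) := by
      refine h3.trans ((mul_le_mul_of_nonneg_left h4 (by positivity)).trans (le_of_eq ?_))
      ring
    exact le_of_mul_le_mul_left h5 (by positivity)
  have b5 : Q.pr (fun ω => η * 2 ^ d ≤ FinProb.count univ
      (fun v ω => HasMiddleTree G (ℓ₁ ω) (ℓ₂ ω) k N v) ω) ≤ γ / 5 := by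
    have h3 := Q.markov (f := FinProb.count univ
      (fun v ω => HasMiddleTree G (ℓ₁ ω) (ℓ₂ ω) k N v)) (fun ω => Nat.cast_nonneg _) (η * 2 ^ d)
    rw [FinProb.ex_count] at h3
    have h4 := sum_le_sum fun v (_ : v ∈ univ) => (hmid' v k).trans hkβ
    rw [sum_const, nsmul_eq_mul, hcardV] at h4
    have h5 : η * 2 ^ d * Q.pr (fun ω => η * 2 ^ d ≤ FinProb.count univ
        (fun v ω => HasMiddleTree G (ℓ₁ ω) (ℓ₂ ω) k N v) ω) ≤ η * 2 ^ d * (γ / 5) := by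
      refine h3.trans (h4.trans (le_of_eq ?_))
      ring
    exact le_of_mul_le_mul_left h5 (by positivity)
  have hmy : |m - y * 2 ^ d| ≤ η * 2 ^ d := by
    have h3 : ∀ v, |(FinProb.pi (Sym2 (Fin d → Bool)) (FinProb.ber p h0 h1)).pr
        (fun ω => LongPath (openSubgraph G ω) k ∅ v) - y| ≤ η := fun v => by
      have h4 := hmean p h0 h1 hp v
      have h5 := abs_sub_le ((FinProb.pi (Sym2 (Fin d → Bool)) (FinProb.ber p h0 h1)).pr
        (fun ω => LongPath (openSubgraph G ω) k ∅ v)) (survival c k) y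
      linarith
    have h4 : m - y * 2 ^ d = ∑ v : Fin d → Bool,
        ((FinProb.pi (Sym2 (Fin d → Bool)) (FinProb.ber p h0 h1)).pr
        (fun ω => LongPath (openSubgraph G ω) k ∅ v) - y) := by
      rw [sum_sub_distrib, sum_const, nsmul_eq_mul, hcardV, mul_comm]
    rw [h4]
    refine (abs_sum_le_sum_abs _ _).trans ((sum_le_sum fun v _ => h3 v).trans (le_of_eq ?_))
    rw [sum_const, nsmul_eq_mul, hcardV, mul_comm]
  rw [hmap₂]
  have hbad := Q.pr_not fun ω => ∃ L₁ : (openSubgraph G (ℓ₂ ω)).ConnectedComponent,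
    |(L₁.supp.ncard : ℝ) - y * 2 ^ d| ≤ ε * (y * 2 ^ d) ∧
      ∀ L, L ≠ L₁ → (L.supp.ncard : ℝ) ≤ d / I
  suffices hgoal : Q.pr (fun ω => ¬ ∃ L₁ : (openSubgraph G (ℓ₂ ω)).ConnectedComponent,
      |(L₁.supp.ncard : ℝ) - y * 2 ^ d| ≤ ε * (y * 2 ^ d) ∧
      ∀ L, L ≠ L₁ → (L.supp.ncard : ℝ) ≤ d / I) ≤ γ by linarith
  have hunion := fun A B : (Sym2 (Fin d → Bool) → Bool × Bool) → Prop => Q.pr_or_le A B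
  refine (Q.pr_mono fun ω hω => ?_).trans ((hunion _ _).trans (add_le_add b1 ((hunion _ _).trans
    (add_le_add b2 ((hunion _ _).trans (add_le_add b3 ((hunion _ _).trans
      (add_le_add b4 b5)))))))) |>.trans ?_
  swap
  · linarith
  by_contra hcon
  simp only [not_or] at hcon
  obtain ⟨c1, c2, c3, c4, c5⟩ := hcon
  refine hω ?_
  push Not at c1 c4 c5
  have hnear' : ∀ v, ∃ i j,
      K < (comp (openSubgraph G (ℓ₁ ω)) (toggle i (toggle j v))).card := fun v => by
    by_contra h
    exact c2 ⟨v, h⟩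
  have hsup : openSubgraph G (ℓ₁ ω) ⊔ openSubgraph G (fun e => (ω e).2) = openSubgraph G (ℓ₂ ω) := by
    ext x y
    simp only [SimpleGraph.sup_adj, openSubgraph, hℓ₁, hℓ₂, Bool.or_eq_true]
    tauto
  obtain ⟨L₁, hL₁, hrest⟩ := exists_giant (hle ω) hKN' hkN' c1 hnear' fun x y hx hy => by
    by_contra h
    refine c3 ⟨⟨fun v hv => ?_, hnear'⟩, x, y, hx, hy, by rw [hsup]; exact h⟩
    by_contra hv'
    -- A first-layer component with size in `(K, N]` would itself supply a middle tree.
    exact c1 v (HasMiddleTree.of_card_comp le_rfl (hle ω) hv (by omega))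
  refine ⟨L₁, ?_, fun L hL => ?_⟩
  · have e1 : |(L₁.supp.ncard : ℝ) - cnt (ℓ₂ ω)| ≤ η * 2 ^ d := hL₁.trans c5.le
    have e2 := abs_sub_le (L₁.supp.ncard : ℝ) (cnt (ℓ₂ ω)) (y * 2 ^ d)
    have e3 := abs_sub_le (cnt (ℓ₂ ω)) m (y * 2 ^ d)
    have e4 : ε * (y * 2 ^ d) = 3 * (η * 2 ^ d) := by rw [hη]; ring
    linarith
  · exact (Nat.le_floor_iff (by positivity)).1 (hrest L hL)

end Assembly

theorem theorem2 (c : ℝ) (hc : 1 < c) (p : ℕ → unitInterval)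
    (hp : ∀ d : ℕ, c ≤ (d : ℝ) → (p d : ℝ) = c / (d : ℝ)) :
    ∃ y : ℝ, 0 < y ∧ y < 1 ∧ y = 1 - Real.exp (-(c * y)) ∧
      (∀ z : ℝ, 0 < z → z = 1 - Real.exp (-(c * z)) → z = y) ∧
      ∀ ε : ℝ, 0 < ε →
        Tendsto
          (fun d : ℕ => (percolation (binaryCube d) (p d)).real
            {H : SimpleGraph (Fin d → Bool) |
              ∃ L₁ : H.ConnectedComponent,
                |(L₁.supp.ncard : ℝ) - y * 2 ^ d| ≤ ε * (y * 2 ^ d) ∧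
                ∀ L : H.ConnectedComponent, L ≠ L₁ →
                  (L.supp.ncard : ℝ) ≤ (d : ℝ) / (c - 1 - Real.log c)})
          atTop (𝓝 1) := by
  obtain ⟨y, hy0, hy1, hfix, huniq, hlim, -⟩ := exists_survival_limit hc
  refine ⟨y, hy0, hy1, hfix, huniq, fun ε hε => ?_⟩
  rw [Metric.tendsto_atTop']
  intro γ hγ
  obtain ⟨d₀, hd₀⟩ := eventually_atTop.1 ((eventually_giant hc hy0 hlim hε (half_pos hγ)).and
    (eventually_ge_atTop ⌈c⌉₊))
  refine ⟨d₀, fun d hd => ?_⟩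
  obtain ⟨h, hdc⟩ := hd₀ d hd.le
  have hcd : c ≤ d := (Nat.le_ceil c).trans (by exact_mod_cast hdc)
  have h3 := h (p d) (p d).2.1 (p d).2.2 (hp d hcd)
  rw [percolation_real (binaryCube d) (p d) fun H => ∃ L₁ : H.ConnectedComponent,
    |(L₁.supp.ncard : ℝ) - y * 2 ^ d| ≤ ε * (y * 2 ^ d) ∧
    ∀ L : H.ConnectedComponent, L ≠ L₁ → (L.supp.ncard : ℝ) ≤ (d : ℝ) / (c - 1 - Real.log c),
    binaryCube_eq_dirCube, Real.dist_eq, abs_lt]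
  have h4 := (FinProb.pi (Sym2 (Fin d → Bool)) (FinProb.ber (p d) (p d).2.1 (p d).2.2)).pr_le_one
    fun ω => ∃ L₁ : (openSubgraph (dirCube Finset.univ) ω).ConnectedComponent,
    |(L₁.supp.ncard : ℝ) - y * 2 ^ d| ≤ ε * (y * 2 ^ d) ∧
    ∀ L, L ≠ L₁ → (L.supp.ncard : ℝ) ≤ (d : ℝ) / (c - 1 - Real.log c)
  constructor <;> linarith
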